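/- There are absolute constants $c_3,c_4>0$ such that the following holds. Let $d\ge 2$, let $w\in\mathbb R^d\setminus\{0\}$, let $0\le\eta<1/2$ and $\gamma=\tfrac12-\eta$, let $r,\delta>0$ with $r\le \frac{\gamma}{c_3\sqrt d}$, and let $$N\ \ge\ \frac{c_4}{(r/2)^d\gamma^2}\,\ln\!\Big(\frac{1}{r^d\gamma\delta}\Big).$$ Place $N$ sensors independently and uniformly at random at points $x_1,\dots,x_N$ of the unit ball of $\mathbb R^d$. The correct state of a sensor at $x$ is positive if $\langle w,x\rangle>0$ and negative otherwise; the separator is the hyperplane $\{y:\langle w,y\rangle=0\}$. Given the locations, the sensors' initial states are independent, and each sensor's initial state is correct with probability at least $1-\eta$ (this probability may vary with the sensor and, measurably, with the locations). The neighbors of a sensor are the other sensors at distance at most $r$ from it. In the conservative best-response dynamics, the sensors update one at a time. When sensor $i$ updates, it considers all hyperplanes through $x_i$ for which each of the two open sides contains at least $1/4$ of the neighbors of $i$. If for every such hyperplane a strict majority of the neighbors on each of the two sides is currently positive, it sets its state to positive; otherwise, if for every such hyperplane a strict majority of the neighbors on each of the two sides is currently negative, it sets its state to negative; otherwise it keeps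 its state. Then with probability at least $1-\delta$ over the locations and initial states, the following holds simultaneously for every sequence of sensors (an update order, in which sensors may repeat): whenever a sensor whose closed $r$-ball $\{y : |y-x_i|\le r\}$ does not intersect the separator updates, its state after the update is correct; and no sensor ever changes from its correct state to its incorrect state. -/

import Mathlib

open MeasureTheory

namespace SensorDenoising

noncomputable section

/-- The space in which the sensors live. -/
abbrev Space (d : ℕ) : Type := EuclideanSpace ℝ (Fin d)

/-- The correct label of a location `x`, for the linear separator through the origin with normal
vector `w`: positive (`true`) on the open positive side and negative (`false`) elsewhere. -/
def target {d : ℕ} (w x : Space d) : Bool := decide (0 < inner ℝ w x)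

/-- The separating hyperplane with normal vector `w`. -/
def separator {d : ℕ} (w : Space d) : Set (Space d) := {y | inner ℝ w y = 0}

/-- The uniform distribution on the closed unit ball. -/
def uniformBall (d : ℕ) : Measure (Space d) :=
  ProbabilityTheory.cond volume (Metric.closedBall 0 1)

/-- The joint law of the sensor locations and the initial states. The `N` locations are independent
and uniform in the unit ball. Given the locations `x`, the initial states are independent, and
sensor `i` has the correct state with probability `q i x`. The `s`-th summand is the part of the law
on which the vector of initial states equals `s`. -/
def initialLaw {d N : ℕ} (w : Space d) (q : Fin N → (Fin N → Space d) → ℝ) :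
    Measure ((Fin N → Space d) × (Fin N → Bool)) :=
  ∑ s : Fin N → Bool,
    ((Measure.pi fun _ : Fin N => uniformBall d).withDensity fun x =>
      ∏ i, ENNReal.ofReal (if s i = target w (x i) then q i x else 1 - q i x)).map
        fun x => (x, s)

open Classical in
/-- The neighbors of sensor `i`: the other sensors within distance `r`. -/
def neighbors {d N : ℕ} (r : ℝ) (x : Fin N → Space d) (i : Fin N) : Finset (Fin N) :=
  Finset.univ.filter fun j => j ≠ i ∧ dist (x i) (x j) ≤ r

open Classical in
/-- The neighbors of sensor `i` that lie strictly on the side to which `v` points of the hyperplane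
through `x i` with normal vector `v`. The other side is `side r x i (-v)`. -/
def side {d N : ℕ} (r : ℝ) (x : Fin N → Space d) (i : Fin N) (v : Space d) : Finset (Fin N) :=
  (neighbors r x i).filter fun j => 0 < inner ℝ v (x j - x i)

/-- The hyperplane through `x i` with normal vector `v` is one that sensor `i` considers: at least
a quarter of the neighbors of `i` lie on each of its sides. -/
def Eligible {d N : ℕ} (r : ℝ) (x : Fin N → Space d) (i : Fin N) (v : Space d) : Prop :=
  v ≠ 0 ∧ (neighbors r x i).card ≤ 4 * (side r x i v).card ∧
    (neighbors r x i).card ≤ 4 * (side r x i (-v)).card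

/-- A strict majority of the sensors in `S` are in state `b`. -/
def Majority {N : ℕ} (s : Fin N → Bool) (b : Bool) (S : Finset (Fin N)) : Prop :=
  (S.filter fun j => s j ≠ b).card < (S.filter fun j => s j = b).card

/-- For every hyperplane that sensor `i` considers, the majority on both sides is in state `b`. -/
def Agreed {d N : ℕ} (r : ℝ) (x : Fin N → Space d) (s : Fin N → Bool) (i : Fin N) (b : Bool) :
    Prop :=
  ∀ v : Space d, Eligible r x i v →
    Majority s b (side r x i v) ∧ Majority s b (side r x i (-v))

open Classical in
/-- The conservative best response of sensor `i` when the current states are `s`. -/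
def response {d N : ℕ} (r : ℝ) (x : Fin N → Space d) (s : Fin N → Bool) (i : Fin N) : Bool :=
  if Agreed r x s i true then true
  else if Agreed r x s i false then false
  else s i

/-- The states after the first `t` updates, when the sensors update one at a time in the order
`u 0, u 1, u 2, …`, starting from the states `s`. -/
def run {d N : ℕ} (r : ℝ) (x : Fin N → Space d) (s : Fin N → Bool) (u : ℕ → Fin N) :
    ℕ → Fin N → Bool
  | 0 => s
  | t + 1 => Function.update (run r x s u t) (u t) (response r x (run r x s u t) (u t))

/-- The dynamics succeed from locations `x` and initial states `s`: for every update order `u`,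
at each time at which a sensor updates whose `r`-ball misses the separator it ends up in
the correct state, and no sensor ever changes from its correct state to its incorrect one. -/
def Succeeds {d N : ℕ} (w : Space d) (r : ℝ) (x : Fin N → Space d) (s : Fin N → Bool) : Prop :=
  ∀ u : ℕ → Fin N, ∀ t : ℕ,
    (Disjoint (Metric.closedBall (x (u t)) r) (separator w) →
      run r x s u (t + 1) (u t) = target w (x (u t))) ∧
    (∀ i, run r x s u t i = target w (x i) → run r x s u (t + 1) i = target w (x i))

end

end SensorDenoising

/-! The dynamics are controlled by two conditions on the initial configuration. Every sensor must
have an eligible hyperplane, parallel to the separator if the sensor is within `r` of it. Every side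
containing at least a quarter of a sensor's neighbors must have a correct majority. The set of
correct sensors then never shrinks, so these majorities persist. A sensor far from the separator
sees one target value and is pushed to it. A correct sensor near the separator is protected by the
parallel hyperplane: the side facing away from the separator vetoes the wrong state
(`succeeds_of_correctMajority`).

Eligibility is geometric. The hyperplane leaves on each side at least 2/5 of the `r`-ball
intersected with the unit ball, because a reflection exchanges the two sides of a hyperplane
orthogonal to the direction of the centre and a thin slab carries at most 1/5 of the volume
(`volume_lens_slab_le`). The smallness of `r` makes the slab absorb the tilt of the separator. An
exponential moment bound turns 2/5 of the volume into 1/4 of the neighbors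
(`measure_four_mul_card_side_lt_le`).

Majorities follow from a Chernoff bound for one side and a union bound over all sides. Half-spaces
with `x i` on the boundary have VC dimension at most `d`, so `n` neighbors have at most `(n + 1) ^
d` sides (`card_sides_le`). Averaging over the random `n` and summing over sensors gives a total
failure probability that the bound on `N` brings below `δ` (`total_failure_le`). -/

namespace SensorDenoising

open scoped ENNReal Pointwise

/-! ### Deterministic analysis of the dynamics. -/

/-- A strict majority of the sensors in `T` are in their correct state. -/
def CorrectMajority {d N : ℕ} (w : Space d) (x : Fin N → Space d) (s : Fin N → Bool)
    (T : Finset (Fin N)) : Prop :=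
  (T.filter fun j => s j ≠ target w (x j)).card < (T.filter fun j => s j = target w (x j)).card

theorem CorrectMajority.mono {d N : ℕ} {w : Space d} {x : Fin N → Space d} {s s' : Fin N → Bool}
    {T : Finset (Fin N)} (h : CorrectMajority w x s T)
    (hs : ∀ j, s j = target w (x j) → s' j = target w (x j)) : CorrectMajority w x s' T := by
  refine lt_of_le_of_lt (Finset.card_le_card ?_) (lt_of_lt_of_le h (Finset.card_le_card ?_))
  · exact Finset.monotone_filter_right T fun j _ hj h' => hj (hs j h')
  · exact Finset.monotone_filter_right T fun j _ hj => hs j hj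

theorem CorrectMajority.majority {d N : ℕ} {w : Space d} {x : Fin N → Space d}
    {s : Fin N → Bool} {T : Finset (Fin N)} {b : Bool} (h : CorrectMajority w x s T)
    (hb : ∀ j ∈ T, target w (x j) = b) : Majority s b T := by
  unfold CorrectMajority at h
  unfold Majority
  have h1 : T.filter (fun j => s j ≠ target w (x j)) = T.filter fun j => s j ≠ b :=
    Finset.filter_congr fun j hj => by rw [hb j hj]
  have h2 : T.filter (fun j => s j = target w (x j)) = T.filter fun j => s j = b :=
    Finset.filter_congr fun j hj => by rw [hb j hj]
  rwa [h1, h2] at h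

theorem Majority.not_majority_not {N : ℕ} {s : Fin N → Bool} {T : Finset (Fin N)} {b : Bool}
    (h : Majority s b T) : ¬ Majority s (!b) T := by
  unfold Majority at *
  rw [not_lt]
  convert h.le using 4 <;> cases b <;> simp

theorem mem_neighbors {d N : ℕ} {r : ℝ} {x : Fin N → Space d} {i j : Fin N} :
    j ∈ neighbors r x i ↔ j ≠ i ∧ dist (x i) (x j) ≤ r := by
  simp [neighbors]

theorem mem_side {d N : ℕ} {r : ℝ} {x : Fin N → Space d} {i j : Fin N} {v : Space d} :
    j ∈ side r x i v ↔ j ∈ neighbors r x i ∧ 0 < inner ℝ v (x j - x i) := by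
  simp [side]

theorem response_eq {d N : ℕ} {r : ℝ} {x : Fin N → Space d} {s : Fin N → Bool} {i : Fin N}
    {b : Bool} (hb : Agreed r x s i b) (hnb : ¬ Agreed r x s i (!b)) : response r x s i = b := by
  cases b <;> simp_all [response]

theorem response_eq_self {d N : ℕ} {r : ℝ} {x : Fin N → Space d} {s : Fin N → Bool} {i : Fin N}
    {b : Bool} (hs : s i = b) (hnb : ¬ Agreed r x s i (!b)) : response r x s i = b := by
  cases b <;> simp_all [response]

/-- Within distance `r` of a point farther than `r` from the separator the target is constant. -/
theorem target_eq_of_dist_le {d : ℕ} {w x y : Space d} {r : ℝ}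
    (hx : r * ‖w‖ < |inner ℝ w x|) (hy : dist x y ≤ r) : target w y = target w x := by
  have h1 : |inner ℝ w (y - x)| ≤ r * ‖w‖ := by
    refine (abs_real_inner_le_norm _ _).trans ?_
    rw [mul_comm, ← dist_eq_norm, dist_comm]
    gcongr
  rw [inner_sub_right] at h1
  unfold target
  congr 1
  rw [eq_iff_iff]
  rw [abs_le] at h1
  rcases lt_abs.1 hx with h | h <;> constructor <;> intro h' <;> nlinarith [norm_nonneg w]

/-- A ball around a point within distance `r` of the separator meets the separator. -/
theorem not_disjoint_separator {d : ℕ} {w x : Space d} {r : ℝ} (hw : w ≠ 0)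
    (hx : |inner ℝ w x| ≤ r * ‖w‖) :
    ¬ Disjoint (Metric.closedBall x r) (separator w) := by
  have hw' : 0 < ‖w‖ := norm_pos_iff.2 hw
  rw [Set.not_disjoint_iff]
  refine ⟨x - (inner ℝ w x / ‖w‖ ^ 2) • w, ?_, ?_⟩
  · rw [Metric.mem_closedBall, dist_eq_norm, sub_sub_cancel_left, norm_neg, norm_smul,
      Real.norm_eq_abs, abs_div, abs_of_pos (pow_pos hw' 2), div_mul_eq_mul_div,
      div_le_iff₀ (by positivity)]
    nlinarith
  · simp only [separator, Set.mem_ofPred_eq, inner_sub_right, inner_smul_right,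
      real_inner_self_eq_norm_sq]
    field_simp
    ring

/-- If every sensor has an eligible hyperplane, which is parallel to the separator for the sensors
near it, and every large side has a correct majority in the initial states, then the dynamics
succeed. -/
theorem succeeds_of_correctMajority {d N : ℕ} {w : Space d} (hw : w ≠ 0) {r : ℝ}
    {x : Fin N → Space d} {s : Fin N → Bool} (D : Space d → Space d)
    (hDw : ∀ y, |inner ℝ w y| ≤ r * ‖w‖ → D y = w)
    (hD : ∀ i, Eligible r x i (D (x i)))
    (hM : ∀ i v, (neighbors r x i).card ≤ 4 * (side r x i v).card →
      CorrectMajority w x s (side r x i v)) :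
    Succeeds w r x s := by
  have far : ∀ (s' : Fin N → Bool), (∀ j, s j = target w (x j) → s' j = target w (x j)) →
      ∀ i, r * ‖w‖ < |inner ℝ w (x i)| → response r x s' i = target w (x i) := by
    intro s' hs' i hi
    have ht : ∀ v, ∀ j ∈ side r x i v, target w (x j) = target w (x i) := fun v j hj =>
      target_eq_of_dist_le hi (mem_neighbors.1 (mem_side.1 hj).1).2
    have hm : ∀ v, (neighbors r x i).card ≤ 4 * (side r x i v).card →
        Majority s' (target w (x i)) (side r x i v) := fun v hv =>
      ((hM i v hv).mono hs').majority (ht v)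
    refine response_eq (fun v hv => ⟨hm v hv.2.1, hm (-v) hv.2.2⟩) fun h => ?_
    -- Without an eligible hyperplane, agreement on the wrong state would hold vacuously.
    exact (hm _ (hD i).2.1).not_majority_not (h _ (hD i)).1
  have near : ∀ (s' : Fin N → Bool), (∀ j, s j = target w (x j) → s' j = target w (x j)) →
      ∀ i, |inner ℝ w (x i)| ≤ r * ‖w‖ → s' i = target w (x i) →
      response r x s' i = target w (x i) := by
    intro s' hs' i hi hsi
    have hel := hD i
    rw [hDw _ hi] at hel
    refine response_eq_self hsi fun h => ?_
    -- Of the two sides of the hyperplane parallel to the separator, take the one facing away from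
    -- it: all its sensors share the target of `i`.
    by_cases hp : 0 < inner ℝ w (x i)
    · have ht : target w (x i) = true := by simpa [target] using hp
      refine (((hM i w hel.2.1).mono hs').majority (b := true) ?_).not_majority_not ?_
      · intro j hj
        have := (mem_side.1 hj).2
        rw [inner_sub_right] at this
        simp only [target, decide_eq_true_eq]
        linarith
      · rw [ht] at h
        exact (h w hel).1
    · have ht : target w (x i) = false := by simpa [target] using hp
      refine (((hM i (-w) hel.2.2).mono hs').majority (b := false) ?_).not_majority_not ?_
      · intro j hj
        have := (mem_side.1 hj).2
        rw [inner_neg_left, inner_sub_right] at this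
        simp only [target, decide_eq_false_iff_not]
        linarith
      · rw [ht] at h
        exact (h w hel).2
  intro u
  have step : ∀ t, (∀ j, s j = target w (x j) → run r x s u t j = target w (x j)) →
      ∀ i, run r x s u t i = target w (x i) → run r x s u (t + 1) i = target w (x i) := by
    intro t ih i hi
    by_cases h : i = u t
    · subst h
      simp only [run, Function.update_self]
      rcases le_or_gt |inner ℝ w (x (u t))| (r * ‖w‖) with h | h
      · exact near _ ih _ h hi
      · exact far _ ih _ h
    · simpa [run, Function.update_of_ne h] using hi
  have inv : ∀ t j, s j = target w (x j) → run r x s u t j = target w (x j) := by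
    intro t
    induction t with
    | zero => exact fun j hj => hj
    | succ t ih => exact fun j hj => step t ih j (ih j hj)
  refine fun t => ⟨fun hdis => ?_, step t (inv t)⟩
  simp only [run, Function.update_self]
  refine far _ (inv t) _ ?_
  by_contra! hle
  exact not_disjoint_separator hw hle hdis

/-! ### Counting the sides: VC dimension and the Sauer–Shelah lemma. -/

open Classical in
/-- The sets of neighbors of sensor `i` cut off by the hyperplanes through it. -/
noncomputable def sides {d N : ℕ} (r : ℝ) (x : Fin N → Space d) (i : Fin N) :
    Finset (Finset (Fin N)) :=
  Finset.univ.filter fun T => ∃ v, side r x i v = T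

-- A shattered set gives linearly independent vectors `x j - x i`. In a linear relation with some
-- positive coefficient, choose `v` cutting out exactly the indices with positive coefficient:
-- pairing the relation with `v` gives nonnegative terms, one of them positive, that sum to zero.
-- The same applied to the negated relation kills the negative coefficients.
open Classical in
theorem card_le_of_shatters_sides {d N : ℕ} {r : ℝ} {x : Fin N → Space d} {i : Fin N}
    {T : Finset (Fin N)} (hT : (sides r x i).Shatters T) : T.card ≤ d := by
  have hsub : T ⊆ neighbors r x i := by
    obtain ⟨t, ht, hTt⟩ := hT.exists_superset
    obtain ⟨v, rfl⟩ := (Finset.mem_filter.1 ht).2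
    exact fun j hj => (mem_side.1 (hTt hj)).1
  have hli : LinearIndependent ℝ fun j : T => x j - x i := by
    have key : ∀ a : Fin N → ℝ, ∑ j ∈ T, a j • (x j - x i) = 0 → ∀ j ∈ T, a j ≤ 0 := by
      intro a ha j₀ hj₀
      by_contra! hpos
      obtain ⟨t, ht, hTt⟩ := hT (Finset.filter_subset (fun j => 0 < a j) T)
      obtain ⟨v, rfl⟩ := (Finset.mem_filter.1 ht).2
      have hmem : ∀ j ∈ T, (0 < inner ℝ v (x j - x i) ↔ 0 < a j) := by
        intro j hj
        have := congrArg (j ∈ ·) hTt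
        simpa [mem_side, hj, hsub hj] using this
      have h0 : ∑ j ∈ T, a j * inner ℝ v (x j - x i) = 0 := by
        have := congrArg (inner ℝ v) ha
        simpa [inner_sum, inner_smul_right] using this
      refine absurd h0 (Finset.sum_pos' (fun j hj => ?_) ⟨j₀, hj₀, ?_⟩).ne'
      · by_cases h : 0 < a j
        · exact (mul_pos h ((hmem j hj).2 h)).le
        · exact mul_nonneg_of_nonpos_of_nonpos (not_lt.1 h)
            (not_lt.1 fun h' => h ((hmem j hj).1 h'))
      · exact mul_pos hpos ((hmem j₀ hj₀).2 hpos)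
    have := linearIndepOn_finset_iff (R := ℝ) (s := T) (v := fun j => x j - x i)
    refine this.2 fun a ha j hj => le_antisymm (key a ha j hj) ?_
    have := key (fun j => -a j) (by simpa using ha) j hj
    linarith
  simpa using hli.fintype_card_le_finrank

open Classical in
theorem card_sides_le {d N : ℕ} (r : ℝ) (x : Fin N → Space d) (i : Fin N) :
    (sides r x i).card ≤ ((neighbors r x i).card + 1) ^ d := by
  have hsub : (sides r x i).shatterer ⊆
      (Finset.range (d + 1)).biUnion fun k => (neighbors r x i).powersetCard k := by
    intro T hT
    rw [Finset.mem_shatterer] at hT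
    simp only [Finset.mem_biUnion, Finset.mem_range, Finset.mem_powersetCard]
    refine ⟨T.card, Nat.lt_succ_of_le (card_le_of_shatters_sides hT), ?_, rfl⟩
    obtain ⟨t, ht, hTt⟩ := hT.exists_superset
    obtain ⟨v, rfl⟩ := (Finset.mem_filter.1 ht).2
    exact fun j hj => (mem_side.1 (hTt hj)).1
  calc (sides r x i).card ≤ _ := Finset.card_le_card_shatterer _
    _ ≤ _ := Finset.card_le_card hsub
    _ ≤ _ := Finset.card_biUnion_le
    -- The surplus factors `1 ^ (d - k)` and `d.choose k` give the sum the shape of the binomial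
    -- theorem.
    _ ≤ ∑ k ∈ Finset.range (d + 1), (neighbors r x i).card ^ k * 1 ^ (d - k) * d.choose k := by
      refine Finset.sum_le_sum fun k hk => ?_
      rw [Finset.card_powersetCard, one_pow, mul_one]
      exact (Nat.choose_le_pow _ _).trans (Nat.le_mul_of_pos_right _
        (Nat.choose_pos (Nat.lt_succ_iff.1 (Finset.mem_range.1 hk))))
    _ = _ := (add_pow _ _ _).symm

/-! ### The law of the initial states and the Chernoff bound for one set. -/

instance isProbabilityMeasure_uniformBall (d : ℕ) : IsProbabilityMeasure (uniformBall d) :=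
  ProbabilityTheory.cond_isProbabilityMeasure_of_finite
    (Metric.measure_closedBall_pos volume _ one_pos).ne' (measure_closedBall_lt_top).ne

/-- The conditional probability of the initial states `s` given the locations `x`. -/
noncomputable def stateWeight {d N : ℕ} (w : Space d) (q : Fin N → (Fin N → Space d) → ℝ)
    (x : Fin N → Space d) (s : Fin N → Bool) : ℝ≥0∞ :=
  ∏ i, ENNReal.ofReal (if s i = target w (x i) then q i x else 1 - q i x)

theorem measurable_target {d : ℕ} (w : Space d) : Measurable (target w) :=
  measurable_to_bool (by
    convert measurableSet_lt (f := fun _ : Space d => (0 : ℝ)) (g := fun x => inner ℝ w x)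
      measurable_const (by fun_prop) using 1
    ext x
    simp [target])

theorem measurable_stateWeight {d N : ℕ} (w : Space d) {q : Fin N → (Fin N → Space d) → ℝ}
    (hq : ∀ i, Measurable (q i)) (s : Fin N → Bool) : Measurable (stateWeight w q · s) := by
  unfold stateWeight
  refine Finset.measurable_prod _ fun i _ => ENNReal.measurable_ofReal.comp ?_
  refine Measurable.ite ?_ (hq i) (measurable_const.sub (hq i))
  exact measurableSet_eq_fun measurable_const ((measurable_target w).comp (measurable_pi_apply i))

open Classical in
theorem initialLaw_apply {d N : ℕ} (w : Space d) {q : Fin N → (Fin N → Space d) → ℝ}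
    (hq : ∀ i, Measurable (q i)) {A : Set ((Fin N → Space d) × (Fin N → Bool))}
    (hA : MeasurableSet A) :
    initialLaw w q A = ∫⁻ x, ∑ s, (if (x, s) ∈ A then stateWeight w q x s else 0)
      ∂(Measure.pi fun _ => uniformBall d) := by
  have hm : ∀ s : Fin N → Bool, MeasurableSet {x : Fin N → Space d | (x, s) ∈ A} := fun s =>
    measurable_prodMk_right hA
  rw [lintegral_finsetSum _ fun s _ =>
    Measurable.ite (hm s) (measurable_stateWeight w hq s) measurable_const]
  unfold initialLaw
  rw [Measure.finsetSum_apply]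
  refine Finset.sum_congr rfl fun s _ => ?_
  rw [Measure.map_apply measurable_prodMk_right hA, withDensity_apply _ (measurable_prodMk_right hA),
    ← lintegral_indicator (measurable_prodMk_right hA)]
  rfl

theorem sum_prod_bool {N : ℕ} {R : Type*} [CommSemiring R] (f : Fin N → Bool → R) :
    ∑ s : Fin N → Bool, ∏ i, f i (s i) = ∏ i, (f i true + f i false) := by
  have := Finset.prod_univ_sum (fun _ : Fin N => (Finset.univ : Finset Bool)) f
  simp only [Fintype.piFinset_univ, Fintype.sum_bool] at this
  exact this.symm

theorem sum_stateWeight {d N : ℕ} (w : Space d) {q : Fin N → (Fin N → Space d) → ℝ}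
    {x : Fin N → Space d} (hq : ∀ i, 0 ≤ q i x ∧ q i x ≤ 1) : ∑ s, stateWeight w q x s = 1 := by
  unfold stateWeight
  rw [sum_prod_bool fun i b => ENNReal.ofReal (if b = target w (x i) then q i x else 1 - q i x)]
  refine Finset.prod_eq_one fun i _ => ?_
  rw [← ENNReal.ofReal_add, ← ENNReal.ofReal_one]
  · congr 1
    cases target w (x i) <;> simp
  · split_ifs <;> linarith [hq i]
  · split_ifs <;> linarith [hq i]

open Classical in
/-- Chernoff bound: a set of sensors rarely lacks a correct majority. -/
theorem sum_stateWeight_not_correctMajority_le {d N : ℕ} (w : Space d)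
    {q : Fin N → (Fin N → Space d) → ℝ} {x : Fin N → Space d} {γ : ℝ} (hγ : 0 < γ) (hγ' : γ ≤ 1 / 2)
    (hq : ∀ i, 1 / 2 + γ ≤ q i x ∧ q i x ≤ 1) (T : Finset (Fin N)) :
    ∑ s, (if CorrectMajority w x s T then 0 else stateWeight w q x s) ≤
      ENNReal.ofReal ((1 - 2 * γ ^ 2) ^ T.card) := by
  -- Correct sensors get weight `y⁻¹` and incorrect ones `y`, so the product is at least 1 when
  -- there is no correct majority. With this `y`, a sensor that is correct with probability exactly
  -- `1 / 2 + γ` has mean weight `1 - 2 * γ ^ 2`; larger probabilities only lower it.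
  set y : ℝ := 1 + 2 * γ with hy
  have hy1 : 1 ≤ y := by linarith
  have hy0 : 0 < y := by linarith
  set g : Fin N → Bool → ℝ := fun i b => if b = target w (x i) then q i x else 1 - q i x with hg
  set h : Fin N → Bool → ℝ := fun i b =>
    if i ∈ T then (if b = target w (x i) then y⁻¹ else y) else 1 with hh
  have hg0 : ∀ i b, 0 ≤ g i b := by
    intro i b
    simp only [hg]
    split_ifs <;> linarith [hq i]
  have hh0 : ∀ i b, 0 ≤ h i b := by
    intro i b
    simp only [hh]
    split_ifs <;> positivity
  have hone : ∀ s : Fin N → Bool, ¬ CorrectMajority w x s T → 1 ≤ ∏ i, h i (s i) := by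
    intro s hs
    unfold CorrectMajority at hs
    rw [not_lt] at hs
    have : ∏ i, h i (s i) = ∏ i ∈ T, (if s i = target w (x i) then y⁻¹ else y) := by
      simp only [hh, Finset.prod_ite_mem, Finset.univ_inter]
    rw [this, Finset.prod_ite, Finset.prod_const, Finset.prod_const, inv_pow,
      ← div_eq_inv_mul, one_le_div (by positivity)]
    exact pow_le_pow_right₀ hy1 hs
  calc ∑ s, (if CorrectMajority w x s T then 0 else stateWeight w q x s)
      ≤ ∑ s : Fin N → Bool, ENNReal.ofReal (∏ i, (g i (s i) * h i (s i))) := by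
        refine Finset.sum_le_sum fun s _ => ?_
        split_ifs with hs
        · exact zero_le
        · unfold stateWeight
          rw [← ENNReal.ofReal_prod_of_nonneg fun i _ => hg0 i (s i)]
          refine ENNReal.ofReal_le_ofReal ?_
          rw [Finset.prod_mul_distrib]
          exact le_mul_of_one_le_right (Finset.prod_nonneg fun i _ => hg0 i (s i)) (hone s hs)
    _ = ENNReal.ofReal (∏ i, (g i true * h i true + g i false * h i false)) := by
        rw [← sum_prod_bool fun i b => g i b * h i b, ENNReal.ofReal_sum_of_nonneg]
        exact fun s _ => Finset.prod_nonneg fun i _ => mul_nonneg (hg0 _ _) (hh0 _ _)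
    _ ≤ _ := by
        refine ENNReal.ofReal_le_ofReal ?_
        rw [← Finset.prod_const, ← Finset.prod_subset (Finset.subset_univ T)]
        · refine Finset.prod_le_prod (fun i _ => add_nonneg (mul_nonneg (hg0 _ _) (hh0 _ _))
            (mul_nonneg (hg0 _ _) (hh0 _ _))) fun i hi => ?_
          have : g i true * h i true + g i false * h i false = q i x * y⁻¹ + (1 - q i x) * y := by
            simp only [hg, hh, hi, if_true]
            cases target w (x i) <;> simp [add_comm]
          rw [this]
          have h1 : y⁻¹ ≤ y := (inv_le_one_of_one_le₀ hy1).trans hy1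
          have h2 : (1 / 2 + γ) * y⁻¹ = 1 / 2 := by
            rw [hy]
            field_simp
          have h3 : (1 / 2 - γ) * y = 1 / 2 - 2 * γ ^ 2 := by
            rw [hy]
            ring
          nlinarith [hq i]
        · intro i _ hi
          simp only [hg, hh, hi, if_false]
          cases target w (x i) <;> simp

/-! ### Measurability of the combinatorial events. -/

theorem measurableSet_mem_neighbors {d N : ℕ} (r : ℝ) (i j : Fin N) :
    MeasurableSet {x : Fin N → Space d | j ∈ neighbors r x i} := by
  simp only [mem_neighbors]
  exact (MeasurableSet.const _).inter (measurableSet_le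
    (f := fun x : Fin N → Space d => dist (x i) (x j)) (by fun_prop) measurable_const)

theorem measurableSet_neighbors_eq {d N : ℕ} (r : ℝ) (i : Fin N) (U : Finset (Fin N)) :
    MeasurableSet {x : Fin N → Space d | neighbors r x i = U} := by
  simp only [Finset.ext_iff, Set.ofPred_forall]
  exact MeasurableSet.iInter fun j => (measurableSet_mem_neighbors r i j).iff (MeasurableSet.const _)

theorem measurable_neighbors_card {d N : ℕ} (r : ℝ) (i : Fin N) :
    Measurable fun x : Fin N → Space d => (neighbors r x i).card := by
  refine measurable_to_countable' fun n => ?_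
  have : (fun x : Fin N → Space d => (neighbors r x i).card) ⁻¹' {n} =
      ⋃ U ∈ {U : Finset (Fin N) | U.card = n}, {x | neighbors r x i = U} := by
    ext x
    simp
  rw [this]
  exact MeasurableSet.biUnion (Set.to_countable _) fun U _ => measurableSet_neighbors_eq r i U

/-- The quantifier over `v` is uncountable, but projecting a closed set along the compact unit ball
keeps it closed. -/
theorem isClosed_setOf_exists_inner {d N : ℕ} (i : Fin N) (ε : ℝ) (A B : Finset (Fin N)) :
    IsClosed {x : Fin N → Space d | ∃ v : Metric.closedBall (0 : Space d) 1,
      (∀ j ∈ A, ε ≤ inner ℝ (v : Space d) (x j - x i)) ∧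
        ∀ j ∈ B, inner ℝ (v : Space d) (x j - x i) ≤ 0} := by
  have hc : IsClosed {p : (Fin N → Space d) × Metric.closedBall (0 : Space d) 1 |
      (∀ j ∈ A, ε ≤ inner ℝ (p.2 : Space d) (p.1 j - p.1 i)) ∧
        ∀ j ∈ B, inner ℝ (p.2 : Space d) (p.1 j - p.1 i) ≤ 0} := by
    simp only [Set.ofPred_and, Set.ofPred_forall]
    refine IsClosed.inter ?_ ?_
    · exact isClosed_biInter fun j _ => isClosed_le continuous_const (by fun_prop)
    · exact isClosed_biInter fun j _ => isClosed_le (by fun_prop) continuous_const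
  have : CompactSpace (Metric.closedBall (0 : Space d) 1) :=
    isCompact_iff_compactSpace.1 (isCompact_closedBall _ _)
  convert isClosedMap_fst_of_compactSpace _ hc using 1
  ext x
  simp

/-- Rescaling puts `v` in the unit ball, and finitely many strict inequalities hold with a common
margin `1 / (n + 1)`. The event is thus a countable union built from the closed sets above. -/
theorem measurableSet_mem_sides {d N : ℕ} (r : ℝ) (i : Fin N) (T : Finset (Fin N)) :
    MeasurableSet {x : Fin N → Space d | T ∈ sides r x i} := by
  classical
  have : {x : Fin N → Space d | T ∈ sides r x i} =
      ⋃ U ∈ {U : Finset (Fin N) | T ⊆ U}, {x | neighbors r x i = U} ∩ ⋃ n : ℕ,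
        {x : Fin N → Space d | ∃ v : Metric.closedBall (0 : Space d) 1,
          (∀ j ∈ T, 1 / ((n : ℝ) + 1) ≤ inner ℝ (v : Space d) (x j - x i)) ∧
            ∀ j ∈ U \ T, inner ℝ (v : Space d) (x j - x i) ≤ 0} := by
    ext x
    simp only [sides, Finset.mem_filter, Finset.mem_univ, true_and, Set.mem_iUnion, Set.mem_inter_iff,
      Set.mem_ofPred_eq, exists_prop]
    constructor
    · rintro ⟨v, rfl⟩
      refine ⟨neighbors r x i, Finset.filter_subset _ _, rfl, ?_⟩
      have hv : 0 < 1 + ‖v‖ := by positivity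
      have hpos : ∀ j ∈ side r x i v, 0 < inner ℝ ((1 + ‖v‖)⁻¹ • v) (x j - x i) := fun j hj => by
        rw [inner_smul_left]
        exact mul_pos (inv_pos.2 hv) (mem_side.1 hj).2
      have : ∀ᶠ n : ℕ in Filter.atTop, ∀ j ∈ side r x i v,
          1 / ((n : ℝ) + 1) < inner ℝ ((1 + ‖v‖)⁻¹ • v) (x j - x i) := by
        rw [Filter.eventually_all_finset]
        exact fun j hj => tendsto_one_div_add_atTop_nhds_zero_nat.eventually_lt_const (hpos j hj)
      obtain ⟨n, hn⟩ := this.exists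
      refine ⟨n, ⟨(1 + ‖v‖)⁻¹ • v, ?_⟩, fun j hj => (hn j hj).le, fun j hj => ?_⟩
      · rw [mem_closedBall_zero_iff, norm_smul, norm_inv, Real.norm_of_nonneg hv.le,
          inv_mul_le_iff₀ hv]
        linarith
      · rw [Finset.mem_sdiff, mem_side, not_and, not_lt] at hj
        change inner ℝ ((1 + ‖v‖)⁻¹ • v) (x j - x i) ≤ 0
        rw [inner_smul_left]
        exact mul_nonpos_of_nonneg_of_nonpos (inv_pos.2 hv).le (hj.2 hj.1)
    · rintro ⟨U, hTU, rfl, n, v, hT, hU⟩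
      refine ⟨v, ?_⟩
      ext j
      rw [mem_side]
      refine ⟨fun h => ?_, fun h => ⟨hTU h, lt_of_lt_of_le (by positivity) (hT j h)⟩⟩
      by_contra hj
      exact absurd (hU j (Finset.mem_sdiff.2 ⟨h.1, hj⟩)) (not_le.2 h.2)
  rw [this]
  exact MeasurableSet.biUnion (Set.to_countable _) fun U _ =>
    (measurableSet_neighbors_eq r i U).inter
      (MeasurableSet.iUnion fun n => (isClosed_setOf_exists_inner i _ T (U \ T)).measurableSet)

/-! ### Integrals of products over independent locations. -/

theorem lintegral_pi_prod {α : Type*} [MeasurableSpace α] (μ : Measure α) [IsProbabilityMeasure μ]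
    (n : ℕ) {g : α → ℝ≥0∞} (hg : Measurable g) :
    ∫⁻ x : Fin n → α, ∏ j, g (x j) ∂(Measure.pi fun _ => μ) = (∫⁻ a, g a ∂μ) ^ n := by
  have h := ProbabilityTheory.iIndepFun_pi (μ := fun _ : Fin n => μ) (X := fun _ => g)
    fun _ => hg.aemeasurable
  rw [ProbabilityTheory.lintegral_prod_eq_prod_lintegral_of_indepFun _ _ h
    fun j => hg.comp (measurable_pi_apply j)]
  have : ∀ j : Fin n, ∫⁻ x : Fin n → α, g (x j) ∂(Measure.pi fun _ => μ) = ∫⁻ a, g a ∂μ := fun j =>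
    (measurePreserving_eval (fun _ : Fin n => μ) j).lintegral_comp hg
  simp [this]

/-- Condition on the location of sensor `i`: the other `N - 1` locations remain independent, so the
integral factors. -/
theorem lintegral_pi_prod_erase_le {α : Type*} [MeasurableSpace α] (μ : Measure α)
    [IsProbabilityMeasure μ] {N : ℕ} (i : Fin N) {g : α → α → ℝ≥0∞}
    (hg : Measurable fun p : α × α => g p.1 p.2) {c : ℝ≥0∞} (hc : ∀ᵐ a ∂μ, ∫⁻ b, g a b ∂μ ≤ c) :
    ∫⁻ x : Fin N → α, ∏ j ∈ Finset.univ.erase i, g (x i) (x j) ∂(Measure.pi fun _ => μ) ≤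
      c ^ (N - 1) := by
  obtain _ | n := N
  · exact i.elim0
  have h1 : ∀ x : Fin (n + 1) → α, ∏ j ∈ Finset.univ.erase i, g (x i) (x j) =
      (fun p : α × (Fin n → α) => ∏ j, g p.1 (p.2 j))
        (MeasurableEquiv.piFinSuccAbove (fun _ => α) i x) := by
    intro x
    have : Finset.univ.erase i = Finset.univ.map i.succAboveEmb := by
      ext j
      simp only [Finset.mem_erase, Finset.mem_univ, and_true, Finset.mem_map, true_and,
        Fin.coe_succAboveEmb, Fin.exists_succAbove_eq_iff]
    rw [this, Finset.prod_map]
    rfl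
  have hm : Measurable fun p : α × (Fin n → α) => ∏ j, g p.1 (p.2 j) :=
    Finset.measurable_prod _ fun j _ => hg.comp (f := fun p : α × (Fin n → α) => (p.1, p.2 j))
      (measurable_fst.prodMk ((measurable_pi_apply j).comp measurable_snd))
  simp_rw [h1]
  rw [(measurePreserving_piFinSuccAbove (fun _ : Fin (n + 1) => μ) i).lintegral_comp hm,
    lintegral_prod _ hm.aemeasurable]
  calc _ ≤ ∫⁻ _, c ^ n ∂μ := by
        refine lintegral_mono_ae (hc.mono fun a ha => ?_)
        have := lintegral_pi_prod μ n (hg.comp (f := fun b : α => (a, b)) measurable_prodMk_left)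
        exact this.trans_le (pow_le_pow_left' ha n)
    _ = _ := by simp

/-! ### Geometry: volumes of half-spaces in an intersection of two balls. -/

/-- Contracting a ball slightly towards an interior point makes room for a shift across a thin
slab. -/
theorem norm_contract_add_smul_le {d : ℕ} (hd : 1 ≤ d) {v u c p : Space d} {r R τ σ : ℝ}
    (hv : ‖v‖ = 1) (hr : 0 < r) (hrR : r ≤ R) (hτ : 0 < τ) (hτr : 783 * τ ^ 2 ≤ r ^ 2 / (4 * d))
    (hu : ‖u - p‖ ≤ R) (hc : ‖c - p‖ ≤ R - r / 2) (hvp : inner ℝ v p = 0) (hvc : inner ℝ v c = 0)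
    (huτ : |inner ℝ v u| ≤ τ) (hσ0 : 0 ≤ σ) (hσ : σ ≤ 27 * τ) :
    ‖(σ • v + (1 / (2 * d) : ℝ) • c) + (1 - 1 / (2 * d) : ℝ) • u - p‖ ≤ R := by
  set l : ℝ := 1 / (2 * d) with hl
  have hd' : (1 : ℝ) ≤ d := by exact_mod_cast hd
  have hl0 : 0 < l := by positivity
  have hl1 : l ≤ 1 / 2 := by
    rw [hl, div_le_div_iff₀ (by positivity) (by norm_num)]
    linarith
  have hlr : r ^ 2 / (4 * d) = l * r ^ 2 / 2 := by
    rw [hl]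
    field_simp
    norm_num
  set y : Space d := (1 - l) • (u - p) + l • (c - p) with hy
  have hyn : ‖y‖ ≤ R - l * r / 2 := by
    calc ‖y‖ ≤ ‖(1 - l) • (u - p)‖ + ‖l • (c - p)‖ := norm_add_le _ _
      _ = (1 - l) * ‖u - p‖ + l * ‖c - p‖ := by
        rw [norm_smul, norm_smul, Real.norm_of_nonneg (by linarith), Real.norm_of_nonneg hl0.le]
      _ ≤ (1 - l) * R + l * (R - r / 2) := by
        gcongr
        linarith
      _ = _ := by ring
  have hvy : inner ℝ v y = (1 - l) * inner ℝ v u := by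
    simp [hy, inner_add_right, inner_smul_right, inner_sub_right, hvp, hvc]
  have heq : (σ • v + l • c) + (1 - l) • u - p = y + σ • v := by
    rw [hy]
    module
  have hvy' : inner ℝ y (σ • v) ≤ σ * τ := by
    rw [inner_smul_right, real_inner_comm, hvy]
    have := (abs_le.1 huτ).2
    refine mul_le_mul_of_nonneg_left ?_ hσ0
    nlinarith
  have hlrR : l * r / 2 ≤ R := by nlinarith
  rw [heq, ← sq_le_sq₀ (norm_nonneg _) (by linarith), norm_add_sq_real, norm_smul, hv, mul_one,
    Real.norm_of_nonneg hσ0]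
  have h1 : ‖y‖ ^ 2 ≤ (R - l * r / 2) ^ 2 := pow_le_pow_left₀ (norm_nonneg _) hyn 2
  -- The shift adds at most `2 * σ * τ + σ ^ 2 ≤ (54 + 729) * τ ^ 2 = 783 * τ ^ 2` to the squared
  -- norm; the contraction frees at least `l * r ^ 2 / 2 = r ^ 2 / (4 * d)`.
  have h2 : σ * τ ≤ 27 * τ ^ 2 := by nlinarith
  have h3 : σ ^ 2 ≤ 729 * τ ^ 2 := by nlinarith
  have h4 : l * r ^ 2 ≤ l * r * R := by nlinarith [mul_pos hl0 hr]
  have h5 : l ^ 2 * r ^ 2 ≤ l * r ^ 2 := by nlinarith [mul_pos hl0 (pow_pos hr 2)]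
  nlinarith

/-- The intersection of two balls, seen from the centre of the first. -/
def lens {d : ℕ} (a : Space d) (r : ℝ) : Set (Space d) :=
  Metric.closedBall 0 r ∩ Metric.closedBall (-a) 1

theorem mem_lens {d : ℕ} {a u : Space d} {r : ℝ} : u ∈ lens a r ↔ ‖u‖ ≤ r ∧ ‖u + a‖ ≤ 1 := by
  simp [lens, dist_eq_norm]

theorem isClosed_lens {d : ℕ} (a : Space d) (r : ℝ) : IsClosed (lens a r) :=
  Metric.isClosed_closedBall.inter Metric.isClosed_closedBall

theorem volume_lens_ne_top {d : ℕ} (a : Space d) (r : ℝ) : volume (lens a r) ≠ ⊤ :=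
  ((measure_mono Set.inter_subset_left).trans_lt measure_closedBall_lt_top).ne

/-- Anticoncentration: a thin slab orthogonal to `v` contains at most a fifth of the lens. -/
theorem volume_lens_slab_le {d : ℕ} (hd : 1 ≤ d) {v a : Space d} {r τ : ℝ}
    (hv : ‖v‖ = 1) (hva : inner ℝ v a = 0) (ha : ‖a‖ ≤ 1) (hr : 0 < r) (hr1 : r ≤ 1) (hτ : 0 < τ)
    (hτr : 783 * τ ^ 2 ≤ r ^ 2 / (4 * d)) :
    5 * volume.real (lens a r ∩ {u | |inner ℝ v u| ≤ τ}) ≤ volume.real (lens a r) := by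
  set S := lens a r ∩ {u | |inner ℝ v u| ≤ τ} with hS
  have hSm : MeasurableSet S :=
    ((isClosed_lens a r).inter (isClosed_le (by fun_prop) continuous_const)).measurableSet
  have hd' : (1 : ℝ) ≤ d := by exact_mod_cast hd
  set l : ℝ := 1 / (2 * d) with hl
  have hl0 : 0 < l := by positivity
  have hl1 : l ≤ 1 / 2 := by
    rw [hl, div_le_div_iff₀ (by positivity) (by norm_num)]
    linarith
  -- This point lies at depth at least `r / 2` in both balls, so contraction towards it serves both
  -- constraints.
  set c : Space d := -(r / 2) • a with hc
  have hvc : inner ℝ v c = 0 := by simp [hc, inner_smul_right, hva]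
  -- Ten contracted copies of the slab, with centres `3 * τ` apart and half-widths at most `τ`, are
  -- disjoint and fit in the lens. Each keeps at least half of the volume of `S` by Bernoulli's
  -- inequality.
  set f : ℕ → Set (Space d) := fun k => ((3 * k * τ) • v + l • c) +ᵥ ((1 - l) • S) with hf
  have hmem : ∀ k y, y ∈ f k → ∃ u ∈ S, y = ((3 * k * τ) • v + l • c) + (1 - l) • u := by
    rintro k y ⟨_, ⟨u, hu, rfl⟩, rfl⟩
    exact ⟨u, hu, rfl⟩
  have hfm : ∀ k, MeasurableSet (f k) := fun k =>
    (hSm.const_smul₀ (1 - l)).const_vadd _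
  have hfv : ∀ k, volume.real (f k) = (1 - l) ^ d * volume.real S := by
    intro k
    rw [measureReal_def, measureReal_def, measure_vadd, Measure.addHaar_smul, ENNReal.toReal_mul,
      ENNReal.toReal_ofReal (abs_nonneg _), finrank_euclideanSpace_fin,
      abs_of_nonneg (pow_nonneg (by linarith) d)]
  have hfd : ∀ k y, y ∈ f k → |inner ℝ v y - 3 * k * τ| ≤ τ := by
    intro k y hy
    obtain ⟨u, hu, rfl⟩ := hmem k y hy
    have : inner ℝ v (((3 * k * τ) • v + l • c) + (1 - l) • u) - 3 * k * τ =
        (1 - l) * inner ℝ v u := by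
      simp only [inner_add_right, inner_smul_right, hvc, real_inner_self_eq_norm_sq, hv]
      ring
    rw [this, abs_mul, abs_of_nonneg (by linarith)]
    exact (mul_le_of_le_one_left (abs_nonneg _) (by linarith)).trans hu.2
  have hdisj : Pairwise (Function.onFun Disjoint f) := by
    have key : ∀ k m : ℕ, k < m → Disjoint (f k) (f m) := by
      intro k m hkm
      rw [Set.disjoint_left]
      intro y hk hm
      have h1 := (abs_le.1 (hfd k y hk)).2
      have h2 := (abs_le.1 (hfd m y hm)).1
      have : (k : ℝ) + 1 ≤ m := by exact_mod_cast hkm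
      nlinarith
    intro k m hkm
    rcases lt_or_gt_of_ne hkm with h | h
    · exact key k m h
    · exact (key m k h).symm
  have hsub : (⋃ k ∈ Finset.range 10, f k) ⊆ lens a r := by
    intro y hy
    simp only [Set.mem_iUnion, Finset.mem_range] at hy
    obtain ⟨k, hk, hy⟩ := hy
    obtain ⟨u, hu, rfl⟩ := hmem k y hy
    have hk' : (k : ℝ) ≤ 9 := by exact_mod_cast Nat.lt_succ_iff.1 hk
    have hσ0 : 0 ≤ 3 * k * τ := by positivity
    have hσ : 3 * k * τ ≤ 27 * τ := by nlinarith
    have hu1 := mem_lens.1 hu.1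
    rw [mem_lens]
    constructor
    · have := norm_contract_add_smul_le hd (p := 0) (c := c) (R := r) hv hr le_rfl hτ hτr
        (by simpa using hu1.1) ?_ (by simp) hvc hu.2 hσ0 hσ
      · rwa [sub_zero] at this
      · rw [sub_zero, hc, norm_smul, norm_neg, Real.norm_of_nonneg (by positivity)]
        nlinarith
    · have := norm_contract_add_smul_le hd (p := -a) (c := c) (R := 1) hv hr hr1 hτ hτr
        (by simpa using hu1.2) ?_ (by simpa using hva) hvc hu.2 hσ0 hσ
      · rwa [sub_neg_eq_add] at this
      · have : c - -a = (1 - r / 2) • a := by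
          rw [hc]
          module
        rw [this, norm_smul, Real.norm_of_nonneg (by linarith)]
        nlinarith
  have hpow : 1 / 2 ≤ (1 - l) ^ d := by
    have h := one_add_mul_le_pow (a := -l) (by linarith) d
    have h2 : (d : ℝ) * -l = -(1 / 2) := by
      rw [hl]
      field_simp
    rw [h2] at h
    calc (1 : ℝ) / 2 = 1 + -(1 / 2) := by norm_num
      _ ≤ _ := h
  calc 5 * volume.real S ≤ 10 * ((1 - l) ^ d * volume.real S) := by
        nlinarith [measureReal_nonneg (μ := volume) (s := S)]
    _ = ∑ k ∈ Finset.range 10, volume.real (f k) := by simp [hfv]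
    _ = volume.real (⋃ k ∈ Finset.range 10, f k) := by
        refine (measureReal_biUnion_finset (fun k _ m _ h => hdisj h) (fun k _ => hfm k) ?_).symm
        intro k _
        rw [measure_vadd, Measure.addHaar_smul]
        exact ENNReal.mul_ne_top ENNReal.ofReal_ne_top
          (measure_ne_top_of_subset Set.inter_subset_left (volume_lens_ne_top a r))
    _ ≤ _ := measureReal_mono hsub (volume_lens_ne_top a r)

/-- At least two fifths of the lens lie beyond a thin slab orthogonal to `v`. -/
theorem volume_lens_halfspace_ge {d : ℕ} (hd : 1 ≤ d) {v a : Space d} {r τ : ℝ}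
    (hv : ‖v‖ = 1) (hva : inner ℝ v a = 0) (ha : ‖a‖ ≤ 1) (hr : 0 < r) (hr1 : r ≤ 1) (hτ : 0 < τ)
    (hτr : 783 * τ ^ 2 ≤ r ^ 2 / (4 * d)) :
    2 * volume.real (lens a r) ≤ 5 * volume.real (lens a r ∩ {u | τ < inner ℝ v u}) := by
  have hslab := volume_lens_slab_le hd hv hva ha hr hr1 hτ hτr
  set F := lens a r ∩ {u | τ < inner ℝ v u} with hF
  set S := lens a r ∩ {u | |inner ℝ v u| ≤ τ} with hS
  set ρ := (ℝ ∙ v)ᗮ.reflection with hρ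
  have hρu : ∀ u, ρ u = u - (2 * inner ℝ v u) • v := fun u => by
    rw [hρ, Submodule.reflection_orthogonal_apply, Submodule.reflection_singleton_apply]
    simp [hv, mul_smul, two_smul]
  -- Since `a` is orthogonal to `v`, the reflection preserves the lens and exchanges the parts
  -- beyond the slab.
  have hsub : lens a r ⊆ (F ∪ ρ ⁻¹' F) ∪ S := by
    intro u hu
    by_cases h1 : |inner ℝ v u| ≤ τ
    · exact Or.inr ⟨hu, h1⟩
    · rcases lt_abs.1 (not_le.1 h1) with h | h
      · exact Or.inl (Or.inl ⟨hu, h⟩)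
      · refine Or.inl (Or.inr ⟨?_, ?_⟩)
        · rw [mem_lens] at hu ⊢
          have hρa : ρ a = a := by simp [hρu, hva]
          refine ⟨by rw [ρ.norm_map]; exact hu.1, ?_⟩
          rw [← hρa, ← map_add, ρ.norm_map]
          exact hu.2
        · change τ < inner ℝ v (ρ u)
          rw [hρu, inner_sub_right, inner_smul_right, real_inner_self_eq_norm_sq, hv]
          linarith
  have hFm : MeasurableSet F :=
    (isClosed_lens a r).measurableSet.inter (measurableSet_lt measurable_const (by fun_prop))
  have hFt : volume F ≠ ⊤ := measure_ne_top_of_subset Set.inter_subset_left (volume_lens_ne_top a r)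
  have hρF : volume (ρ ⁻¹' F) = volume F := ρ.measurePreserving.measure_preimage hFm.nullMeasurableSet
  have h1 : volume.real (lens a r) ≤ volume.real ((F ∪ ρ ⁻¹' F) ∪ S) := by
    refine measureReal_mono hsub (measure_union_ne_top (measure_union_ne_top hFt (hρF ▸ hFt)) ?_)
    exact measure_ne_top_of_subset Set.inter_subset_left (volume_lens_ne_top a r)
  have h2 := measureReal_union_le (μ := volume) (F ∪ ρ ⁻¹' F) S
  have h3 := measureReal_union_le (μ := volume) F (ρ ⁻¹' F)
  have h4 : volume.real (ρ ⁻¹' F) = volume.real F := by rw [measureReal_def, hρF, measureReal_def]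
  linarith

/-- The lens bound moved to a general centre. Only `v` has to be orthogonal to `x - o`; the normal
`D` of interest may be tilted, as long as the slab of half-width `τ` covers the discrepancy. -/
theorem volume_inter_halfspace_ge {d : ℕ} (hd : 1 ≤ d) {x o v D : Space d} {r τ : ℝ}
    (hv : ‖v‖ = 1) (hvo : inner ℝ v (x - o) = 0) (hxo : ‖x - o‖ ≤ 1) (hr : 0 < r) (hr1 : r ≤ 1)
    (hτ : 0 < τ) (hτr : 783 * τ ^ 2 ≤ r ^ 2 / (4 * d))
    (hD : ∀ u, ‖u‖ ≤ r → τ < inner ℝ v u → 0 < inner ℝ D u) :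
    2 * volume.real (Metric.closedBall o 1 ∩ Metric.closedBall x r) ≤
      5 * volume.real (Metric.closedBall o 1 ∩
        (Metric.closedBall x r ∩ {y | 0 < inner ℝ D (y - x)})) := by
  have hK : Metric.closedBall o 1 ∩ Metric.closedBall x r = x +ᵥ lens (x - o) r := by
    ext y
    rw [Set.mem_vadd_set_iff_neg_vadd_mem, mem_lens, vadd_eq_add, neg_add_eq_sub,
      sub_add_sub_cancel, Set.mem_inter_iff, mem_closedBall_iff_norm, mem_closedBall_iff_norm,
      and_comm]
  have hF : x +ᵥ (lens (x - o) r ∩ {u | τ < inner ℝ v u}) ⊆ Metric.closedBall o 1 ∩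
        (Metric.closedBall x r ∩ {y | 0 < inner ℝ D (y - x)}) := by
    rw [Set.vadd_set_inter, ← hK]
    rintro y ⟨⟨hy1, hy2⟩, hy3⟩
    rw [Set.mem_vadd_set_iff_neg_vadd_mem, vadd_eq_add, neg_add_eq_sub] at hy3
    exact ⟨hy1, hy2, hD _ (mem_closedBall_iff_norm.1 hy2) hy3⟩
  have h1 := volume_lens_halfspace_ge hd hv hvo hxo hr hr1 hτ hτr
  have h2 := measureReal_mono (μ := volume) hF
    (measure_ne_top_of_subset Set.inter_subset_left measure_closedBall_lt_top.ne)
  rw [measureReal_def, measure_vadd, ← measureReal_def] at h2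
  rw [hK, measureReal_def, measure_vadd, ← measureReal_def]
  linarith

theorem volume_halfspace_ge_of_inner_eq_zero {d : ℕ} (hd : 1 ≤ d) {x D : Space d} {r : ℝ}
    (hx : ‖x‖ ≤ 1) (hr : 0 < r) (hr1 : r ≤ 1) (hD : D ≠ 0) (hDx : inner ℝ D x = 0) :
    2 * volume.real (Metric.closedBall 0 1 ∩ Metric.closedBall x r) ≤
      5 * volume.real (Metric.closedBall 0 1 ∩
        (Metric.closedBall x r ∩ {y | 0 < inner ℝ D (y - x)})) := by
  have hD' : 0 < ‖D‖ := norm_pos_iff.2 hD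
  have hd' : (1 : ℝ) ≤ d := by exact_mod_cast hd
  refine volume_inter_halfspace_ge hd (v := ‖D‖⁻¹ • D) (τ := r / (60 * d)) ?_ ?_ ?_ hr hr1
    (by positivity) ?_ ?_
  · rw [norm_smul, norm_inv, norm_norm, inv_mul_cancel₀ hD'.ne']
  · simp [inner_smul_left, hDx]
  · simpa using hx
  · rw [div_pow, ← mul_div_assoc, div_le_div_iff₀ (by positivity) (by positivity)]
    nlinarith [mul_nonneg (sq_nonneg r) (sub_nonneg.2 hd'),
      mul_nonneg (mul_nonneg (sq_nonneg r) (sub_nonneg.2 hd')) (by linarith : (0 : ℝ) ≤ d),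
      sq_nonneg r, mul_nonneg (sq_nonneg r) (by linarith : (0 : ℝ) ≤ d)]
  · intro u _ hu
    rw [inner_smul_left] at hu
    have : 0 < ‖D‖⁻¹ * inner ℝ D u := lt_trans (by positivity) hu
    exact pos_of_mul_pos_right this (by positivity)

theorem volume_halfspace_ge_of_inner_le {d : ℕ} (hd : 1 ≤ d) {x D : Space d} {r : ℝ}
    (hx : ‖x‖ ≤ 1) (hr : 0 < r) (hrd : 160000 * (d * r ^ 2) ≤ 1) (hD : D ≠ 0)
    (hDx : |inner ℝ D x| ≤ r * ‖D‖) :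
    2 * volume.real (Metric.closedBall 0 1 ∩ Metric.closedBall x r) ≤
      5 * volume.real (Metric.closedBall 0 1 ∩
        (Metric.closedBall x r ∩ {y | 0 < inner ℝ D (y - x)})) := by
  have hD' : 0 < ‖D‖ := norm_pos_iff.2 hD
  have hd' : (1 : ℝ) ≤ d := by exact_mod_cast hd
  have hr400 : r ≤ 1 / 400 := by
    nlinarith [mul_nonneg (sub_nonneg.2 hd') (sq_nonneg r)]
  rcases le_or_gt ‖x‖ (1 / 2) with hx2 | hx2
  -- Here the small ball lies inside the unit ball, which may therefore be recentred at `x`, making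
  -- the orthogonality condition void.
  · have h := volume_inter_halfspace_ge hd (x := x) (o := x) (D := D) (r := r)
      (v := ‖D‖⁻¹ • D) (τ := r / (60 * d))
      (by rw [norm_smul, norm_inv, norm_norm, inv_mul_cancel₀ hD'.ne'])
      (by simp) (by simp) hr (by linarith) (by positivity) ?_ ?_
    · have h1 : Metric.closedBall x r ⊆ Metric.closedBall x 1 :=
        Metric.closedBall_subset_closedBall (by linarith)
      have h0 : Metric.closedBall x r ⊆ Metric.closedBall 0 1 := by
        refine Metric.closedBall_subset_closedBall' ?_
        rw [dist_zero_right]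
        linarith
      rw [Set.inter_eq_right.2 h1, Set.inter_eq_right.2 (Set.inter_subset_left.trans h1)] at h
      rwa [Set.inter_eq_right.2 h0, Set.inter_eq_right.2 (Set.inter_subset_left.trans h0)]
    · rw [div_pow, ← mul_div_assoc, div_le_div_iff₀ (by positivity) (by positivity)]
      nlinarith [mul_nonneg (sq_nonneg r) (sub_nonneg.2 hd'),
        mul_nonneg (mul_nonneg (sq_nonneg r) (sub_nonneg.2 hd')) (by linarith : (0 : ℝ) ≤ d),
        sq_nonneg r, mul_nonneg (sq_nonneg r) (by linarith : (0 : ℝ) ≤ d)]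
    · intro u _ hu
      rw [inner_smul_left] at hu
      have : 0 < ‖D‖⁻¹ * inner ℝ D u := lt_trans (by positivity) hu
      exact pos_of_mul_pos_right this (by positivity)
  · have hx0 : 0 < ‖x‖ := by linarith
    set e : Space d := ‖D‖⁻¹ • D with he
    have hen : ‖e‖ = 1 := by rw [he, norm_smul, norm_inv, norm_norm, inv_mul_cancel₀ hD'.ne']
    set h : ℝ := inner ℝ e x with hh
    have hhr : |h| ≤ r := by
      rw [hh, he, inner_smul_left, abs_mul]
      simp only [conj_trivial, abs_inv, abs_norm]
      rw [inv_mul_le_iff₀ hD']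
      linarith
    set e' : Space d := e - (h / ‖x‖ ^ 2) • x with he'
    have hproj : ‖(h / ‖x‖ ^ 2) • x‖ ≤ 2 * r := by
      rw [norm_smul, Real.norm_eq_abs, abs_div, abs_of_pos (pow_pos hx0 2), div_mul_eq_mul_div,
        div_le_iff₀ (by positivity)]
      nlinarith [mul_le_mul_of_nonneg_right hhr hx0.le, mul_pos hr hx0]
    have he'n : 1 / 2 ≤ ‖e'‖ := by
      have := norm_sub_norm_le e ((h / ‖x‖ ^ 2) • x)
      rw [hen] at this
      linarith
    have he'0 : 0 < ‖e'‖ := by linarith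
    -- Removing from `e` its component along `x` changes inner products on the `r`-ball by at most
    -- `2 * r ^ 2`. As `‖e'‖ ≥ 1 / 2`, the half-width `4 * r ^ 2` covers this change, and it is
    -- admissible because `d * r ^ 2` is small.
    refine volume_inter_halfspace_ge hd (v := ‖e'‖⁻¹ • e') (τ := 4 * r ^ 2) ?_ ?_ ?_ hr
      (by linarith) (by positivity) ?_ ?_
    · rw [norm_smul, norm_inv, norm_norm, inv_mul_cancel₀ he'0.ne']
    · have : inner ℝ e' x = 0 := by
        rw [he', inner_sub_left, inner_smul_left x x, ← hh, real_inner_self_eq_norm_sq]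
        simp only [conj_trivial]
        rw [div_mul_cancel₀ _ (by positivity), sub_self]
      rw [sub_zero, inner_smul_left, this, mul_zero]
    · simpa using hx
    · rw [le_div_iff₀ (by positivity)]
      nlinarith [mul_le_mul_of_nonneg_right hrd (sq_nonneg r)]
    · intro u hu hu'
      rw [inner_smul_left] at hu'
      simp only [conj_trivial] at hu'
      rw [lt_inv_mul_iff₀ he'0] at hu'
      have h1 : |inner ℝ ((h / ‖x‖ ^ 2) • x) u| ≤ 2 * r * r :=
        (abs_real_inner_le_norm _ _).trans (by gcongr)
      have h2 : inner ℝ e u = inner ℝ e' u + inner ℝ ((h / ‖x‖ ^ 2) • x) u := by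
        rw [← inner_add_left, he', sub_add_cancel]
      have h3 : 0 < inner ℝ e u := by
        rw [h2]
        have := (abs_le.1 h1).1
        nlinarith [mul_le_mul_of_nonneg_right he'n (by positivity : 0 ≤ 4 * r ^ 2)]
      rw [he, inner_smul_left] at h3
      exact pos_of_mul_pos_right h3 (inv_pos.2 hD').le

/-! ### The uniform distribution and the splitting hyperplane. -/

theorem uniformBall_real_apply (d : ℕ) (A : Set (Space d)) :
    (uniformBall d).real A = (volume.real (Metric.closedBall (0 : Space d) 1))⁻¹ *
      volume.real (Metric.closedBall 0 1 ∩ A) := by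
  rw [measureReal_def, uniformBall, ProbabilityTheory.cond_apply measurableSet_closedBall,
    ENNReal.toReal_mul, ENNReal.toReal_inv, measureReal_def, measureReal_def]

theorem ae_uniformBall_norm_le (d : ℕ) : ∀ᵐ x ∂(uniformBall d), ‖x‖ ≤ 1 :=
  (ProbabilityTheory.ae_cond_mem measurableSet_closedBall).mono fun x hx => by simpa using hx

theorem uniformBall_real_halfspace_ge {d : ℕ} {x D : Space d} {r : ℝ}
    (h : 2 * volume.real (Metric.closedBall 0 1 ∩ Metric.closedBall x r) ≤
      5 * volume.real (Metric.closedBall 0 1 ∩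
        (Metric.closedBall x r ∩ {y | 0 < inner ℝ D (y - x)}))) :
    2 * (uniformBall d).real (Metric.closedBall x r) ≤
      5 * (uniformBall d).real (Metric.closedBall x r ∩ {y | 0 < inner ℝ D (y - x)}) := by
  rw [uniformBall_real_apply, uniformBall_real_apply]
  have : 0 ≤ (volume.real (Metric.closedBall (0 : Space d) 1))⁻¹ := inv_nonneg.2 measureReal_nonneg
  nlinarith [mul_le_mul_of_nonneg_left h this]

/-- Moving `x` inwards to `(1 - r / 2) • x` gives a centre whose ball of radius `r / 2` lies in both
balls. -/
theorem pow_le_uniformBall_real {d : ℕ} {x : Space d} (hx : ‖x‖ ≤ 1) {r : ℝ} (hr : 0 < r)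
    (hr1 : r ≤ 1) : (r / 2) ^ d ≤ (uniformBall d).real (Metric.closedBall x r) := by
  have hpos : 0 < volume.real (Metric.closedBall (0 : Space d) 1) :=
    ENNReal.toReal_pos (Metric.measure_closedBall_pos volume _ one_pos).ne'
      measure_closedBall_lt_top.ne
  have hsub : Metric.closedBall ((1 - r / 2) • x) (r / 2) ⊆
      Metric.closedBall 0 1 ∩ Metric.closedBall x r := by
    refine Set.subset_inter ?_ ?_ <;> refine Metric.closedBall_subset_closedBall' ?_
    · rw [dist_zero_right, norm_smul, Real.norm_of_nonneg (by linarith)]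
      nlinarith
    · have : (1 - r / 2) • x - x = -((r / 2) • x) := by module
      rw [dist_eq_norm, this, norm_neg, norm_smul, Real.norm_of_nonneg (by linarith)]
      nlinarith
  have h1 : volume.real (Metric.closedBall ((1 - r / 2) • x) (r / 2)) =
      (r / 2) ^ d * volume.real (Metric.closedBall (0 : Space d) 1) := by
    rw [measureReal_def, Measure.addHaar_closedBall' _ _ (by positivity), ENNReal.toReal_mul,
      ENNReal.toReal_ofReal (by positivity), finrank_euclideanSpace_fin, measureReal_def]
  have h2 := measureReal_mono (μ := volume) hsub
    (measure_ne_top_of_subset Set.inter_subset_left measure_closedBall_lt_top.ne)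
  rw [uniformBall_real_apply, inv_mul_eq_div, le_div_iff₀ hpos]
  linarith

/-- A nonzero vector orthogonal to `x`, depending measurably on `x`. -/
noncomputable def perp {d : ℕ} (hd : 2 ≤ d) (x : Space d) : Space d :=
  if x ⟨0, by omega⟩ = 0 then EuclideanSpace.single ⟨0, by omega⟩ 1
  else EuclideanSpace.single ⟨0, by omega⟩ (x ⟨1, by omega⟩) -
    EuclideanSpace.single ⟨1, by omega⟩ (x ⟨0, by omega⟩)

theorem inner_perp {d : ℕ} (hd : 2 ≤ d) (x : Space d) : inner ℝ (perp hd x) x = 0 := by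
  unfold perp
  split_ifs with h
  · simp [EuclideanSpace.inner_single_left, h]
  · simp [inner_sub_left, EuclideanSpace.inner_single_left, mul_comm]

theorem perp_ne_zero {d : ℕ} (hd : 2 ≤ d) (x : Space d) : perp hd x ≠ 0 := by
  unfold perp
  split_ifs with h
  · simp
  · intro h0
    have := congrArg (fun y : Space d => y ⟨1, by omega⟩) h0
    simp [h] at this

theorem measurable_perp {d : ℕ} (hd : 2 ≤ d) : Measurable (perp hd) := by
  unfold perp
  refine Measurable.ite ?_ measurable_const (Continuous.measurable ?_)
  · exact measurableSet_eq_fun (by fun_prop) measurable_const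
  · have hs : ∀ i : Fin d, Continuous fun t : ℝ => (EuclideanSpace.single i t : Space d) := by
      intro i
      have : (fun t : ℝ => (EuclideanSpace.single i t : Space d)) =
          fun t => t • EuclideanSpace.single i (1 : ℝ) := by
        ext t j
        simp
      rw [this]
      fun_prop
    exact ((hs _).comp (by fun_prop)).sub ((hs _).comp (by fun_prop))

open Classical in
/-- The normal vector of a hyperplane through `x` that splits the neighborhood of `x` evenly; near
the separator it is parallel to the separator. -/
noncomputable def splitter {d : ℕ} (hd : 2 ≤ d) (w : Space d) (r : ℝ) (x : Space d) : Space d :=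
  if |inner ℝ w x| ≤ r * ‖w‖ then w else perp hd x

theorem splitter_ne_zero {d : ℕ} (hd : 2 ≤ d) {w : Space d} (hw : w ≠ 0) (r : ℝ) (x : Space d) :
    splitter hd w r x ≠ 0 := by
  unfold splitter
  split_ifs
  exacts [hw, perp_ne_zero hd x]

theorem measurable_splitter {d : ℕ} (hd : 2 ≤ d) (w : Space d) (r : ℝ) :
    Measurable (splitter hd w r) := by
  unfold splitter
  exact Measurable.ite (measurableSet_le (by fun_prop) measurable_const) measurable_const
    (measurable_perp hd)

theorem uniformBall_real_splitter {d : ℕ} (hd : 2 ≤ d) {w : Space d} (hw : w ≠ 0) {r : ℝ}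
    (hr : 0 < r) (hrd : 160000 * (d * r ^ 2) ≤ 1) {x : Space d} (hx : ‖x‖ ≤ 1) {v : Space d}
    (hv : v = splitter hd w r x ∨ v = -splitter hd w r x) :
    2 * (uniformBall d).real (Metric.closedBall x r) ≤
      5 * (uniformBall d).real (Metric.closedBall x r ∩ {y | 0 < inner ℝ v (y - x)}) := by
  have hd' : (2 : ℝ) ≤ d := by exact_mod_cast hd
  have hr1 : r ≤ 1 := by nlinarith [mul_nonneg (sub_nonneg.2 hd') (sq_nonneg r)]
  refine uniformBall_real_halfspace_ge ?_
  have hv0 : v ≠ 0 := by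
    rcases hv with rfl | rfl
    · exact splitter_ne_zero hd hw r x
    · exact neg_ne_zero.2 (splitter_ne_zero hd hw r x)
  by_cases h : |inner ℝ w x| ≤ r * ‖w‖
  · refine volume_halfspace_ge_of_inner_le (by omega) hx hr hrd hv0 ?_
    rcases hv with rfl | rfl <;> simp [splitter, h]
  · refine volume_halfspace_ge_of_inner_eq_zero (by omega) hx hr hr1 hv0 ?_
    rcases hv with rfl | rfl <;> simp [splitter, h, inner_perp]

/-! ### Exponential moments of neighbor counts. -/

open Classical in
theorem lintegral_ofReal_ite {α : Type*} [MeasurableSpace α] (μ : Measure α)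
    [IsProbabilityMeasure μ] {A F : Set α} (hA : MeasurableSet A) (hF : MeasurableSet F)
    {a b : ℝ} (ha : 0 ≤ a) (hb : 0 ≤ b) :
    ∫⁻ y, ENNReal.ofReal (if y ∈ A then if y ∈ F then a else b else 1) ∂μ =
      ENNReal.ofReal (1 + (b - 1) * μ.real A + (a - b) * μ.real (A ∩ F)) := by
  have h1 : ∀ y, (if y ∈ A then if y ∈ F then a else b else 1) =
      1 + A.indicator (fun _ => b - 1) y + (A ∩ F).indicator (fun _ => a - b) y := by
    intro y
    by_cases hyA : y ∈ A <;> by_cases hyF : y ∈ F <;> simp [hyA, hyF]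
  have hiA : Integrable (A.indicator fun _ => b - 1) μ := (integrable_const _).indicator hA
  have hiF : Integrable ((A ∩ F).indicator fun _ => a - b) μ :=
    (integrable_const _).indicator (hA.inter hF)
  rw [← ofReal_integral_eq_lintegral_ofReal]
  · simp_rw [h1]
    rw [integral_add (by fun_prop) hiF, integral_add (by fun_prop) hiA,
      integral_indicator_const _ hA, integral_indicator_const _ (hA.inter hF)]
    simp [mul_comm]
  · simp_rw [h1]
    fun_prop
  · exact Filter.Eventually.of_forall fun y => by
      dsimp only
      split_ifs <;> simp [ha, hb]

open Classical in
theorem prod_erase_ite_eq {d N : ℕ} (r : ℝ) (x : Fin N → Space d) (i : Fin N) (v : Space d)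
    (a b : ℝ) :
    ∏ j ∈ Finset.univ.erase i, (if x j ∈ Metric.closedBall (x i) r then
        if x j ∈ {y | 0 < inner ℝ v (y - x i)} then a else b else 1) =
      a ^ (side r x i v).card * b ^ ((neighbors r x i).card - (side r x i v).card) := by
  rw [← Finset.prod_filter, Finset.prod_ite, Finset.prod_const, Finset.prod_const]
  have h1 : ((Finset.univ.erase i).filter fun j => x j ∈ Metric.closedBall (x i) r) =
      neighbors r x i := by
    ext j
    simp [mem_neighbors, dist_comm]
  rw [h1]
  have h2 : ((neighbors r x i).filter fun j => x j ∈ {y | 0 < inner ℝ v (y - x i)}) =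
      side r x i v := rfl
  rw [h2, ← h2, Finset.filter_not, Finset.card_sdiff_of_subset (Finset.filter_subset _ _)]

theorem measurable_ofReal_ite {d : ℕ} (r : ℝ) {D : Space d → Space d} (hD : Measurable D)
    (a b : ℝ) [∀ p : Space d × Space d, Decidable (p.2 ∈ Metric.closedBall p.1 r)]
    [∀ p : Space d × Space d, Decidable (p.2 ∈ {y | 0 < inner ℝ (D p.1) (y - p.1)})] :
    Measurable fun p : Space d × Space d => ENNReal.ofReal
      (if p.2 ∈ Metric.closedBall p.1 r then
        if p.2 ∈ {y | 0 < inner ℝ (D p.1) (y - p.1)} then a else b else 1) := by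
  refine ENNReal.measurable_ofReal.comp (Measurable.ite ?_
    (Measurable.ite ?_ measurable_const measurable_const) measurable_const)
  · exact measurableSet_le (f := fun p : Space d × Space d => dist p.2 p.1) (by fun_prop)
      measurable_const
  · exact measurableSet_lt (g := fun p : Space d × Space d => inner ℝ (D p.1) (p.2 - p.1))
      measurable_const ((hD.comp measurable_fst).inner (measurable_snd.sub measurable_fst))

theorem measure_one_le_pi_prod_erase_le {α : Type*} [MeasurableSpace α] (μ : Measure α)
    [IsProbabilityMeasure μ] {N : ℕ} (i : Fin N) {g : α → α → ℝ≥0∞}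
    (hg : Measurable fun p : α × α => g p.1 p.2) {c : ℝ≥0∞} (hc : ∀ᵐ a ∂μ, ∫⁻ b, g a b ∂μ ≤ c) :
    (Measure.pi fun _ : Fin N => μ) {x | 1 ≤ ∏ j ∈ Finset.univ.erase i, g (x i) (x j)} ≤
      c ^ (N - 1) := by
  have hm : Measurable fun x : Fin N → α => ∏ j ∈ Finset.univ.erase i, g (x i) (x j) :=
    Finset.measurable_prod _ fun j _ => hg.comp (f := fun x : Fin N → α => (x i, x j))
      ((measurable_pi_apply i).prodMk (measurable_pi_apply j))
  have h := mul_meas_ge_le_lintegral hm 1 (μ := Measure.pi fun _ : Fin N => μ)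
  rw [one_mul] at h
  exact h.trans (lintegral_pi_prod_erase_le μ i hg hc)

-- Weight 64/125 on the positive side and 5/4 on the rest of the `r`-ball. If the positive side has
-- at least 2/5 of the mass `A` of that ball, the mean weight is at most `1 - 0.0452 * A`, and `A ≥
-- (r / 2) ^ d`.
open Classical in
theorem lintegral_splitting_weight_le {d : ℕ} {r : ℝ} (hr : 0 < r) (hr1 : r ≤ 1) {x v : Space d}
    (hx : ‖x‖ ≤ 1) (hv : 2 * (uniformBall d).real (Metric.closedBall x r) ≤
      5 * (uniformBall d).real (Metric.closedBall x r ∩ {y | 0 < inner ℝ v (y - x)})) :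
    ∫⁻ y, ENNReal.ofReal (if y ∈ Metric.closedBall x r then
      if y ∈ {y | 0 < inner ℝ v (y - x)} then 64 / 125 else 5 / 4 else 1) ∂(uniformBall d) ≤
      ENNReal.ofReal (1 - (r / 2) ^ d / 25) := by
  have hF : MeasurableSet {y | 0 < inner ℝ v (y - x)} :=
    measurableSet_lt measurable_const (by fun_prop)
  rw [lintegral_ofReal_ite _ measurableSet_closedBall hF (by norm_num) (by norm_num)]
  refine ENNReal.ofReal_le_ofReal ?_
  have h2 := pow_le_uniformBall_real hx hr hr1
  have h3 : 0 ≤ (r / 2) ^ d := by positivity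
  generalize (r / 2) ^ d = P at *
  linarith

/-- The weights are chosen so that `64 / 125 = (5 / 4) ^ (-3)`: the product is `(5 / 4) ^ (n - 4 *
m)`, which breaks even at a quarter. -/
theorem one_le_pow_mul_pow_sub {m n : ℕ} (h : 4 * m < n) :
    (1 : ℝ) ≤ (64 / 125) ^ m * (5 / 4) ^ (n - m) := by
  have h45 : (64 / 125 : ℝ) ^ m = ((5 / 4 : ℝ) ^ (3 * m))⁻¹ := by
    rw [pow_mul, ← inv_pow]
    norm_num
  rw [h45, inv_mul_eq_div, one_le_div (by positivity)]
  exact pow_le_pow_right₀ (by norm_num) (by omega)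

/-- A hyperplane through sensor `i` that splits its neighborhood fairly evenly is unlikely to
have less than a quarter of the neighbors on its positive side. -/
theorem measure_four_mul_card_side_lt_le {d N : ℕ} {r : ℝ} (hr : 0 < r) (hr1 : r ≤ 1)
    {D : Space d → Space d} (hDm : Measurable D)
    (hD : ∀ x, ‖x‖ ≤ 1 → 2 * (uniformBall d).real (Metric.closedBall x r) ≤
      5 * (uniformBall d).real (Metric.closedBall x r ∩ {y | 0 < inner ℝ (D x) (y - x)}))
    (i : Fin N) :
    (Measure.pi fun _ : Fin N => uniformBall d)
      {x | 4 * (side r x i (D (x i))).card < (neighbors r x i).card} ≤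
      ENNReal.ofReal (1 - (r / 2) ^ d / 25) ^ (N - 1) := by
  classical
  refine le_trans (measure_mono ?_) (measure_one_le_pi_prod_erase_le (uniformBall d) i
    (measurable_ofReal_ite r hDm (64 / 125) (5 / 4))
    ((ae_uniformBall_norm_le d).mono fun x hx => lintegral_splitting_weight_le hr hr1 hx (hD x hx)))
  intro x hx
  rw [Set.mem_ofPred_eq] at hx ⊢
  rw [← ENNReal.ofReal_prod_of_nonneg fun j _ => by split_ifs <;> norm_num,
    prod_erase_ite_eq, ← ENNReal.ofReal_one]
  exact ENNReal.ofReal_le_ofReal (one_le_pow_mul_pow_sub hx)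

theorem lintegral_pow_card_neighbors_le {d N : ℕ} {r : ℝ} (hr : 0 < r) (hr1 : r ≤ 1)
    {β : ℝ} (hβ0 : 0 ≤ β) (hβ1 : β ≤ 1) (i : Fin N) :
    ∫⁻ x, ENNReal.ofReal ((1 - β) ^ (neighbors r x i).card)
      ∂(Measure.pi fun _ : Fin N => uniformBall d) ≤
      ENNReal.ofReal (1 - (r / 2) ^ d * β) ^ (N - 1) := by
  classical
  -- Both branches carry the same weight, so the half-space with normal 0 is a dummy that allows
  -- reuse of the two-weight formulas.
  set g : Space d → Space d → ℝ≥0∞ := fun x y => ENNReal.ofReal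
    (if y ∈ Metric.closedBall x r then
      if y ∈ {y | 0 < inner ℝ (0 : Space d) (y - x)} then 1 - β else 1 - β else 1) with hg
  have hgm : Measurable fun p : Space d × Space d => g p.1 p.2 :=
    measurable_ofReal_ite r (D := fun _ => 0) measurable_const _ _
  refine le_trans (lintegral_mono fun x => ?_)
    (lintegral_pi_prod_erase_le (uniformBall d) i hgm ?_)
  · have hle : (side r x i 0).card ≤ (neighbors r x i).card :=
      Finset.card_le_card (Finset.filter_subset _ _)
    rw [hg, ← ENNReal.ofReal_prod_of_nonneg fun j _ => by split_ifs <;> linarith,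
      prod_erase_ite_eq, ← pow_add, Nat.add_sub_cancel' hle]
  · filter_upwards [ae_uniformBall_norm_le d] with x hx
    have hF : MeasurableSet {y : Space d | 0 < inner ℝ (0 : Space d) (y - x)} :=
      measurableSet_lt measurable_const (by fun_prop)
    rw [hg]
    dsimp only
    rw [lintegral_ofReal_ite _ measurableSet_closedBall hF (by linarith) (by linarith)]
    refine ENNReal.ofReal_le_ofReal ?_
    have h2 := pow_le_uniformBall_real hx hr hr1
    nlinarith

/-! ### Failure of a correct majority around one sensor. -/

theorem initialLaw_fst_le {d N : ℕ} (w : Space d) {q : Fin N → (Fin N → Space d) → ℝ}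
    (hq : ∀ i, Measurable (q i)) (hq' : ∀ i x, 0 ≤ q i x ∧ q i x ≤ 1)
    (A : Set (Fin N → Space d)) :
    initialLaw w q {p | p.1 ∈ A} ≤ (Measure.pi fun _ => uniformBall d) A := by
  classical
  set B := toMeasurable (Measure.pi fun _ : Fin N => uniformBall d) A with hB
  have hBm : MeasurableSet B := measurableSet_toMeasurable _ _
  calc initialLaw w q {p | p.1 ∈ A} ≤ initialLaw w q (Prod.fst ⁻¹' B) :=
        measure_mono fun p hp => subset_toMeasurable _ _ hp
    _ = ∫⁻ x, B.indicator 1 x ∂(Measure.pi fun _ => uniformBall d) := by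
        rw [initialLaw_apply w hq (measurable_fst hBm)]
        refine lintegral_congr fun x => ?_
        by_cases hx : x ∈ B
        · simp [hx, sum_stateWeight w fun i => hq' i x]
        · simp [hx]
    _ = _ := by rw [lintegral_indicator_one hBm, hB, measure_toMeasurable]

theorem measurableSet_correctMajority {d N : ℕ} (w : Space d) (T : Finset (Fin N)) :
    MeasurableSet {p : (Fin N → Space d) × (Fin N → Bool) | CorrectMajority w p.1 p.2 T} := by
  have hm : Measurable fun p : (Fin N → Space d) × (Fin N → Bool) =>
      ((fun j => target w (p.1 j) : Fin N → Bool), p.2) :=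
    (measurable_pi_lambda _ fun j => (measurable_target w).comp
      ((measurable_pi_apply j).comp measurable_fst)).prodMk measurable_snd
  exact hm (Set.to_countable {c : (Fin N → Bool) × (Fin N → Bool) |
    (T.filter fun j => c.2 j ≠ c.1 j).card < (T.filter fun j => c.2 j = c.1 j).card}).measurableSet

/-- Some large side of a hyperplane through sensor `i` lacks a correct majority. -/
def LacksMajority {d N : ℕ} (w : Space d) (r : ℝ) (i : Fin N) (x : Fin N → Space d)
    (s : Fin N → Bool) : Prop :=
  ∃ T ∈ sides r x i, (neighbors r x i).card ≤ 4 * T.card ∧ ¬ CorrectMajority w x s T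

theorem measurableSet_lacksMajority {d N : ℕ} (w : Space d) (r : ℝ) (i : Fin N) :
    MeasurableSet {p : (Fin N → Space d) × (Fin N → Bool) | LacksMajority w r i p.1 p.2} := by
  have : {p : (Fin N → Space d) × (Fin N → Bool) | LacksMajority w r i p.1 p.2} =
      ⋃ T : Finset (Fin N), (Prod.fst ⁻¹' {x | T ∈ sides r x i}) ∩
        ((Prod.fst ⁻¹' ((fun x => (neighbors r x i).card) ⁻¹' {n | n ≤ 4 * T.card})) ∩
          {p | CorrectMajority w p.1 p.2 T}ᶜ) := by
    ext p
    simp [LacksMajority]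
  rw [this]
  exact MeasurableSet.iUnion fun T => (measurable_fst (measurableSet_mem_sides r i T)).inter
    ((measurable_fst (measurable_neighbors_card r i (MeasurableSet.of_discrete))).inter
      (measurableSet_correctMajority w T).compl)

-- Union bound over the large sides. Each has at least `n / 4` members, which turns the rate `2 * γ
-- ^ 2` per member into `γ ^ 2 / 2` per neighbor.
open Classical in
theorem sum_stateWeight_lacksMajority_le {d N : ℕ} (w : Space d)
    {q : Fin N → (Fin N → Space d) → ℝ} {x : Fin N → Space d} {γ : ℝ} (hγ : 0 < γ) (hγ' : γ ≤ 1 / 2)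
    (hq : ∀ i, 1 / 2 + γ ≤ q i x ∧ q i x ≤ 1) (r : ℝ) (i : Fin N) :
    ∑ s, (if LacksMajority w r i x s then stateWeight w q x s else 0) ≤
      ENNReal.ofReal (((neighbors r x i).card + 1) ^ d *
        Real.exp (-(γ ^ 2 / 2)) ^ (neighbors r x i).card) := by
  set n := (neighbors r x i).card with hn
  set big := (sides r x i).filter fun T => n ≤ 4 * T.card with hbig
  have hcard : (big.card : ℝ) ≤ ((n : ℝ) + 1) ^ d := by
    exact_mod_cast (Finset.card_filter_le _ _).trans (card_sides_le r x i)
  have hterm : ∀ T ∈ big, ∑ s, (if CorrectMajority w x s T then 0 else stateWeight w q x s) ≤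
      ENNReal.ofReal (Real.exp (-(γ ^ 2 / 2)) ^ n) := by
    intro T hT
    refine (sum_stateWeight_not_correctMajority_le w hγ hγ' hq T).trans
      (ENNReal.ofReal_le_ofReal ?_)
    have hT' : (n : ℝ) ≤ 4 * T.card := by exact_mod_cast (Finset.mem_filter.1 hT).2
    calc (1 - 2 * γ ^ 2) ^ T.card ≤ Real.exp (-(2 * γ ^ 2)) ^ T.card := by
          refine pow_le_pow_left₀ (by nlinarith) ?_ _
          linarith [Real.add_one_le_exp (-(2 * γ ^ 2))]
      _ ≤ _ := by
          rw [← Real.exp_nat_mul, ← Real.exp_nat_mul, Real.exp_le_exp]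
          nlinarith [mul_le_mul_of_nonneg_left hT' (sq_nonneg γ)]
  calc ∑ s, (if LacksMajority w r i x s then stateWeight w q x s else 0)
      ≤ ∑ s, ∑ T ∈ big, (if CorrectMajority w x s T then 0 else stateWeight w q x s) := by
        refine Finset.sum_le_sum fun s _ => ?_
        split_ifs with h
        · obtain ⟨T, hT, hnT, hmaj⟩ := h
          refine le_trans ?_ (Finset.single_le_sum (fun _ _ => zero_le)
            (Finset.mem_filter.2 ⟨hT, hnT⟩))
          rw [if_neg hmaj]
        · exact zero_le
    _ = ∑ T ∈ big, ∑ s, (if CorrectMajority w x s T then 0 else stateWeight w q x s) :=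
        Finset.sum_comm
    _ ≤ ∑ T ∈ big, ENNReal.ofReal (Real.exp (-(γ ^ 2 / 2)) ^ n) := Finset.sum_le_sum hterm
    _ = ENNReal.ofReal (big.card * Real.exp (-(γ ^ 2 / 2)) ^ n) := by
        rw [Finset.sum_const, nsmul_eq_mul, ENNReal.ofReal_mul (by positivity),
          ENNReal.ofReal_natCast]
    _ ≤ _ := ENNReal.ofReal_le_ofReal (mul_le_mul_of_nonneg_right hcard (by positivity))

/-! ### Numerical estimates. -/

/-- A polynomial factor is absorbed into half of an exponential decay. -/
theorem add_one_pow_mul_exp_pow_le {d n : ℕ} (hd : 1 ≤ d) {γ : ℝ} (hγ : 0 < γ) (hγ' : γ ≤ 1 / 2) :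
    ((n : ℝ) + 1) ^ d * Real.exp (-(γ ^ 2 / 2)) ^ n ≤
      2 * (4 * d / γ ^ 2) ^ d * (1 - γ ^ 2 / 8) ^ n := by
  have hd' : (1 : ℝ) ≤ d := by exact_mod_cast hd
  have hd0 : (0 : ℝ) < d := by linarith
  have hγ2 : γ ^ 2 ≤ 1 / 4 := by nlinarith
  -- Half of the decay rate: one factor `exp (-t) ^ n` cancels the growth of the polynomial, the
  -- other survives. The factor 2 in the bound pays for `exp t`, which comes from `n + 1` in place
  -- of `n`.
  set t : ℝ := γ ^ 2 / 4 with ht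
  have ht0 : 0 < t := by positivity
  have hexp : Real.exp (-t) ≤ 1 - γ ^ 2 / 8 := by
    rw [Real.exp_neg, inv_le_iff_one_le_mul₀ (Real.exp_pos _)]
    nlinarith [Real.add_one_le_exp t]
  have hexp2 : Real.exp t ≤ 2 := by
    have h1 : 1 - t ≤ Real.exp (-t) := by linarith [Real.add_one_le_exp (-t)]
    have h2 : Real.exp t * Real.exp (-t) = 1 := by rw [← Real.exp_add, add_neg_cancel, Real.exp_zero]
    nlinarith [Real.exp_pos t]
  have hpoly : ((n : ℝ) + 1) ^ d ≤ (4 * d / γ ^ 2) ^ d * (Real.exp t * Real.exp t ^ n) := by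
    have h1 : (n : ℝ) + 1 ≤ (4 * d / γ ^ 2) * Real.exp ((n + 1) * t / d) := by
      have h2 : (n : ℝ) + 1 = (4 * d / γ ^ 2) * ((n + 1) * t / d) := by
        rw [ht]
        field_simp
      calc (n : ℝ) + 1 = (4 * d / γ ^ 2) * ((n + 1) * t / d) := h2
        _ ≤ _ := by
          gcongr
          linarith [Real.add_one_le_exp ((n + 1) * t / d)]
    refine (pow_le_pow_left₀ (by positivity) h1 d).trans_eq ?_
    rw [mul_pow, ← Real.exp_nat_mul, ← Real.exp_nat_mul, ← Real.exp_add]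
    congr 2
    field_simp
    ring
  have hsplit : Real.exp (-(γ ^ 2 / 2)) = Real.exp (-t) * Real.exp (-t) := by
    rw [← Real.exp_add, ht]
    ring_nf
  have hcancel : Real.exp t ^ n * Real.exp (-t) ^ n = 1 := by
    rw [← mul_pow, ← Real.exp_add, add_neg_cancel, Real.exp_zero, one_pow]
  calc ((n : ℝ) + 1) ^ d * Real.exp (-(γ ^ 2 / 2)) ^ n
      ≤ (4 * d / γ ^ 2) ^ d * (Real.exp t * Real.exp t ^ n) *
          Real.exp (-(γ ^ 2 / 2)) ^ n := by gcongr
    _ = Real.exp t * (4 * d / γ ^ 2) ^ d * Real.exp (-t) ^ n := by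
        rw [hsplit, mul_pow]
        linear_combination (Real.exp t * (4 * d / γ ^ 2) ^ d * Real.exp (-t) ^ n) * hcancel
    _ ≤ _ := by gcongr

theorem one_sub_pow_sub_one_le {X : ℝ} {N : ℕ} (hX1 : X ≤ 1 / 32) (hN1 : 1 ≤ N) :
    (1 - X) ^ (N - 1) ≤ 2 * Real.exp (-(X * N)) := by
  have h1 : 1 - X ≤ Real.exp (-X) := by linarith [Real.add_one_le_exp (-X)]
  have h2 : Real.exp X ≤ 2 := by
    have h3 : Real.exp X * Real.exp (-X) = 1 := by
      rw [← Real.exp_add, add_neg_cancel, Real.exp_zero]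
    nlinarith [Real.exp_pos X]
  calc (1 - X) ^ (N - 1) ≤ Real.exp (-X) ^ (N - 1) := pow_le_pow_left₀ (by linarith) h1 _
    _ = Real.exp X * Real.exp (-(X * N)) := by
      rw [← Real.exp_nat_mul, ← Real.exp_add, Nat.cast_sub hN1]
      push_cast
      ring_nf
    _ ≤ _ := by gcongr

/-- Half of the exponent absorbs the factor `N`, the other half yields the power of `Y`. -/
theorem mul_exp_neg_le {X Y : ℝ} {N : ℕ} (hX : 0 < X) (hY : 0 < Y)
    (h : 8 * Real.log (1 / Y) ≤ X / 2 * N) :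
    N * Real.exp (-(X * N)) ≤ (X / 2)⁻¹ * Y ^ 8 := by
  have h1 : X / 2 * N ≤ Real.exp (X / 2 * N) := by linarith [Real.add_one_le_exp (X / 2 * N)]
  have h2 : Real.exp (-(X / 2 * N)) ≤ Y ^ 8 := by
    calc Real.exp (-(X / 2 * N)) ≤ Real.exp ((8 : ℕ) * Real.log Y) := by
          rw [Real.exp_le_exp]
          rw [one_div, Real.log_inv] at h
          push_cast
          linarith
      _ = _ := by rw [Real.exp_nat_mul, Real.exp_log hY]
  have h4 : Real.exp (-(X * N)) = Real.exp (-(X / 2 * N)) * Real.exp (-(X / 2 * N)) := by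
    rw [← Real.exp_add]
    ring_nf
  have h5 : N * Real.exp (-(X / 2 * N)) ≤ (X / 2)⁻¹ := by
    rw [Real.exp_neg, ← div_eq_mul_inv, div_le_iff₀ (Real.exp_pos _), inv_mul_eq_div,
      le_div_iff₀ (by positivity)]
    linarith
  rw [h4, ← mul_assoc]
  exact mul_le_mul h5 h2 (Real.exp_pos _).le (by positivity)

/-- The total failure probability is at most `δ` when there are enough sensors. -/
theorem total_failure_le {d N : ℕ} (hd : 2 ≤ d) {γ r δ : ℝ} (hγ : 0 < γ) (hγ' : γ ≤ 1 / 2)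
    (hr : 0 < r) (hδ : 0 < δ) (hδ1 : δ ≤ 1) (hrd : r ≤ γ / (200 * Real.sqrt d))
    (hN : 128 / ((r / 2) ^ d * γ ^ 2) * Real.log (1 / (r ^ d * γ * δ)) ≤ (N : ℝ)) (hN1 : 1 ≤ N) :
    N * (2 * (1 - (r / 2) ^ d / 25) ^ (N - 1) +
      2 * (4 * d / γ ^ 2) ^ d * (1 - (r / 2) ^ d * (γ ^ 2 / 8)) ^ (N - 1)) ≤ δ := by
  have hd' : (2 : ℝ) ≤ d := by exact_mod_cast hd
  have hsq : Real.sqrt d ^ 2 = d := Real.sq_sqrt (by linarith)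
  have hs1 : 1 ≤ Real.sqrt d := Real.one_le_sqrt.2 (by linarith)
  have hrs : r * (200 * Real.sqrt d) ≤ γ := (le_div_iff₀ (by positivity)).1 hrd
  have hr400 : r ≤ 1 / 400 := by nlinarith
  have hdr : 40000 * (d * r ^ 2) ≤ γ ^ 2 := by
    have := pow_le_pow_left₀ (by positivity) hrs 2
    nlinarith
  have hγ2 : γ ^ 2 ≤ 1 / 4 := by nlinarith
  set P : ℝ := (r / 2) ^ d with hP
  set R : ℝ := r ^ d with hR
  have hR0 : 0 < R := by positivity
  have hP0 : 0 < P := by positivity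
  have hP1 : P ≤ 1 := pow_le_one₀ (by positivity) (by linarith)
  have hRr : R ≤ 1 / 400 := (pow_le_of_le_one hr.le (by linarith) (by omega)).trans hr400
  have hPR : R ^ 2 ≤ P := by
    rw [hR, hP, ← pow_mul, mul_comm, pow_mul]
    exact pow_le_pow_left₀ (by positivity) (by nlinarith) d
  -- The bound on `r` gives `4 * d * r ^ 2 ≤ γ ^ 2`, so the entropy factor costs only two powers of
  -- `R`.
  have hC : (4 * d / γ ^ 2) ^ d ≤ (R ^ 2)⁻¹ := by
    rw [hR, ← pow_mul, mul_comm d 2, pow_mul, ← inv_pow]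
    refine pow_le_pow_left₀ (by positivity) ?_ d
    rw [div_le_iff₀ (by positivity), inv_mul_eq_div, le_div_iff₀ (by positivity)]
    nlinarith [mul_pos (by linarith : (0 : ℝ) < d) (pow_pos hr 2)]
  have hRinv : 1 ≤ (R ^ 2)⁻¹ := (one_le_inv₀ (by positivity)).2 (by nlinarith)
  -- The slower of the two decay rates; it dominates both kinds of failure.
  set X : ℝ := P * (γ ^ 2 / 8) with hX
  have hX0 : 0 < X := by positivity
  have hX1 : X ≤ 1 / 32 := by nlinarith
  have hXP : X ≤ P / 25 := by nlinarith
  have hE1 := one_sub_pow_sub_one_le hX1 hN1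
  have hE2 : (1 - P / 25) ^ (N - 1) ≤ (1 - X) ^ (N - 1) :=
    pow_le_pow_left₀ (by linarith) (by linarith) _
  -- The constant 128 makes the exponent 8, since `X / 2 * 128 / (P * γ ^ 2) = 8`. Eight powers of
  -- `R * γ * δ` outweigh `R ^ (-2)`, `P⁻¹ ≤ R ^ (-2)` and `γ ^ (-2)`.
  have hlog : 8 * Real.log (1 / (R * γ * δ)) ≤ X / 2 * N := by
    have := mul_le_mul_of_nonneg_left hN (by positivity : 0 ≤ X / 2)
    refine le_trans (le_of_eq ?_) this
    rw [← mul_assoc]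
    congr 1
    rw [hX]
    field_simp
    norm_num
  have hNexp := mul_exp_neg_le hX0 (by positivity : 0 < R * γ * δ) hlog
  have hX2 : 0 ≤ (1 - X) ^ (N - 1) := pow_nonneg (by linarith) _
  calc N * (2 * (1 - P / 25) ^ (N - 1) + 2 * (4 * d / γ ^ 2) ^ d * (1 - X) ^ (N - 1))
      ≤ N * (2 * 1 * (1 - X) ^ (N - 1) + 2 * (R ^ 2)⁻¹ * (1 - X) ^ (N - 1)) := by
        rw [mul_one]
        gcongr
    _ ≤ N * (2 * (R ^ 2)⁻¹ * (1 - X) ^ (N - 1) + 2 * (R ^ 2)⁻¹ * (1 - X) ^ (N - 1)) := by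
        gcongr
    _ = 4 * (R ^ 2)⁻¹ * (N * (1 - X) ^ (N - 1)) := by ring
    _ ≤ 4 * (R ^ 2)⁻¹ * (N * (2 * Real.exp (-(X * N)))) := by gcongr
    _ = 8 * (R ^ 2)⁻¹ * (N * Real.exp (-(X * N))) := by ring
    _ ≤ 8 * (R ^ 2)⁻¹ * ((X / 2)⁻¹ * (R * γ * δ) ^ 8) := by gcongr
    _ = 128 * R ^ 6 * γ ^ 6 * δ ^ 8 / P := by
        rw [hX]
        field_simp
        norm_num
    _ ≤ 128 * R ^ 6 * γ ^ 6 * δ ^ 8 / R ^ 2 := by gcongr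
    _ = 128 * R ^ 4 * γ ^ 6 * δ ^ 8 := by field_simp
    _ ≤ 128 * (1 / 400) ^ 4 * (1 / 2) ^ 6 * δ := by
        have : δ ^ 8 ≤ δ := pow_le_of_le_one hδ.le hδ1 (by norm_num)
        gcongr
    _ ≤ δ := by linarith

/-! ### Union bound over the sensors and conclusion. -/

theorem initialLaw_lacksMajority_le {d N : ℕ} (hd : 1 ≤ d) (w : Space d)
    {q : Fin N → (Fin N → Space d) → ℝ} (hqm : ∀ i, Measurable (q i)) {γ r : ℝ} (hγ : 0 < γ)
    (hγ' : γ ≤ 1 / 2) (hr : 0 < r) (hr1 : r ≤ 1) (hq : ∀ i x, 1 / 2 + γ ≤ q i x ∧ q i x ≤ 1)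
    (i : Fin N) :
    initialLaw w q {p | LacksMajority w r i p.1 p.2} ≤
      ENNReal.ofReal (2 * (4 * d / γ ^ 2) ^ d * (1 - (r / 2) ^ d * (γ ^ 2 / 8)) ^ (N - 1)) := by
  classical
  have hγ2 : γ ^ 2 / 8 ≤ 1 := by nlinarith
  have hP : (r / 2) ^ d * (γ ^ 2 / 8) ≤ 1 :=
    mul_le_one₀ (pow_le_one₀ (by positivity) (by linarith)) (by positivity) hγ2
  rw [initialLaw_apply w hqm (measurableSet_lacksMajority w r i)]
  calc _ ≤ ∫⁻ x : Fin N → Space d, ENNReal.ofReal (2 * (4 * d / γ ^ 2) ^ d) *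
        ENNReal.ofReal ((1 - γ ^ 2 / 8) ^ (neighbors r x i).card)
          ∂(Measure.pi fun _ => uniformBall d) := by
        refine lintegral_mono fun x => ?_
        refine (sum_stateWeight_lacksMajority_le w hγ hγ' (fun i => hq i x) r i).trans ?_
        rw [← ENNReal.ofReal_mul (by positivity)]
        exact ENNReal.ofReal_le_ofReal (add_one_pow_mul_exp_pow_le hd hγ hγ')
    _ = ENNReal.ofReal (2 * (4 * d / γ ^ 2) ^ d) * ∫⁻ x : Fin N → Space d,
        ENNReal.ofReal ((1 - γ ^ 2 / 8) ^ (neighbors r x i).card)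
          ∂(Measure.pi fun _ => uniformBall d) := lintegral_const_mul' _ _ ENNReal.ofReal_ne_top
    _ ≤ _ := by
        rw [ENNReal.ofReal_mul (p := 2 * (4 * d / γ ^ 2) ^ d) (by positivity),
          ENNReal.ofReal_pow (p := 1 - (r / 2) ^ d * (γ ^ 2 / 8)) (by linarith)]
        gcongr
        exact lintegral_pow_card_neighbors_le hr hr1 (by positivity) hγ2 i

/-- Unless some sensor lacks an eligible hyperplane or a correct majority, the dynamics succeed. -/
theorem setOf_not_succeeds_subset {d N : ℕ} (hd : 2 ≤ d) {w : Space d} (hw : w ≠ 0) (r : ℝ) :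
    {p : (Fin N → Space d) × (Fin N → Bool) | ¬ Succeeds w r p.1 p.2} ⊆
      ⋃ i, (({p | p.1 ∈ {x | 4 * (side r x i (splitter hd w r (x i))).card <
          (neighbors r x i).card}} ∪
        {p | p.1 ∈ {x | 4 * (side r x i (-splitter hd w r (x i))).card <
          (neighbors r x i).card}}) ∪
        {p | LacksMajority w r i p.1 p.2}) := by
  classical
  intro p hp
  by_contra hgood
  simp only [Set.mem_iUnion, Set.mem_union, Set.mem_ofPred_eq, not_exists, not_or, not_lt]
    at hgood
  refine hp (succeeds_of_correctMajority hw (splitter hd w r) (fun y hy => if_pos hy)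
    (fun i => ⟨splitter_ne_zero hd hw r _, (hgood i).1.1, (hgood i).1.2⟩) fun i v hv => ?_)
  by_contra hmaj
  exact (hgood i).2 ⟨side r p.1 i v, by simp [sides], hv, hmaj⟩

theorem initialLaw_not_succeeds_le {d N : ℕ} (hd : 2 ≤ d) {w : Space d} (hw : w ≠ 0)
    {q : Fin N → (Fin N → Space d) → ℝ} (hqm : ∀ i, Measurable (q i)) {γ r : ℝ} (hγ : 0 < γ)
    (hγ' : γ ≤ 1 / 2) (hr : 0 < r) (hrd : 160000 * (d * r ^ 2) ≤ 1)
    (hq : ∀ i x, 1 / 2 + γ ≤ q i x ∧ q i x ≤ 1) :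
    initialLaw w q {p | ¬ Succeeds w r p.1 p.2} ≤
      ENNReal.ofReal (N * (2 * (1 - (r / 2) ^ d / 25) ^ (N - 1) +
        2 * (4 * d / γ ^ 2) ^ d * (1 - (r / 2) ^ d * (γ ^ 2 / 8)) ^ (N - 1))) := by
  have hd' : (2 : ℝ) ≤ d := by exact_mod_cast hd
  have hr1 : r ≤ 1 := by nlinarith [mul_nonneg (sub_nonneg.2 hd') (sq_nonneg r)]
  have hP1 : (r / 2) ^ d ≤ 1 := pow_le_one₀ (by positivity) (by linarith)
  have hP0 : 0 ≤ (r / 2) ^ d := by positivity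
  have hγ2 : γ ^ 2 / 8 ≤ 1 := by nlinarith
  set e₁ : ℝ := (1 - (r / 2) ^ d / 25) ^ (N - 1) with he₁
  set e₂ : ℝ := 2 * (4 * d / γ ^ 2) ^ d * (1 - (r / 2) ^ d * (γ ^ 2 / 8)) ^ (N - 1) with he₂
  have h₁ : 0 ≤ e₁ := pow_nonneg (by linarith) _
  have h₂ : 0 ≤ e₂ := mul_nonneg (by positivity) (pow_nonneg
    (by linarith [mul_le_one₀ hP1 (by positivity) hγ2]) _)
  have hq01 : ∀ i x, 0 ≤ q i x ∧ q i x ≤ 1 := fun i x => ⟨by linarith [(hq i x).1], (hq i x).2⟩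
  have hside : ∀ D : Space d → Space d, Measurable D →
      (∀ x, D x = splitter hd w r x ∨ D x = -splitter hd w r x) → ∀ i : Fin N,
      initialLaw w q {p | p.1 ∈ {x | 4 * (side r x i (D (x i))).card < (neighbors r x i).card}} ≤
        ENNReal.ofReal e₁ := by
    intro D hDm hD i
    refine (initialLaw_fst_le w hqm hq01 _).trans ?_
    rw [he₁, ENNReal.ofReal_pow (by linarith)]
    exact measure_four_mul_card_side_lt_le hr hr1 hDm
      (fun x hx => uniformBall_real_splitter hd hw hr hrd hx (hD x)) i
  have hm := measurable_splitter hd w r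
  calc initialLaw w q {p | ¬ Succeeds w r p.1 p.2}
      ≤ _ := measure_mono (setOf_not_succeeds_subset hd hw r)
    _ ≤ _ := measure_iUnion_fintype_le _ _
    _ ≤ ∑ _i : Fin N, ENNReal.ofReal (2 * e₁ + e₂) := by
        refine Finset.sum_le_sum fun i _ => (measure_union_le _ _).trans ?_
        rw [two_mul, ENNReal.ofReal_add (by positivity) h₂, ENNReal.ofReal_add h₁ h₁]
        refine add_le_add ((measure_union_le _ _).trans (add_le_add ?_ ?_)) ?_
        · exact hside _ hm (fun x => Or.inl rfl) i
        · exact hside (fun x => -splitter hd w r x) hm.neg (fun x => Or.inr rfl) i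
        · exact initialLaw_lacksMajority_le (by omega) w hqm hγ hγ' hr hr1 hq i
    _ = _ := by
        rw [Finset.sum_const, Finset.card_univ, Fintype.card_fin, nsmul_eq_mul,
          ENNReal.ofReal_mul (by positivity), ENNReal.ofReal_natCast]

end SensorDenoising

theorem mainTheorem4 :
    ∃ c₃ c₄ : ℝ, 0 < c₃ ∧ 0 < c₄ ∧
      ∀ (d : ℕ), 2 ≤ d →
      ∀ (w : SensorDenoising.Space d), w ≠ 0 →
      ∀ (η r δ : ℝ), 0 ≤ η → η < 1 / 2 → 0 < r → 0 < δ →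
        r ≤ (1 / 2 - η) / (c₃ * Real.sqrt d) →
      ∀ (N : ℕ),
        c₄ / ((r / 2) ^ d * (1 / 2 - η) ^ 2) * Real.log (1 / (r ^ d * (1 / 2 - η) * δ)) ≤ (N : ℝ) →
      ∀ (q : Fin N → (Fin N → SensorDenoising.Space d) → ℝ),
        (∀ i, Measurable (q i)) → (∀ i x, 1 - η ≤ q i x ∧ q i x ≤ 1) →
        SensorDenoising.initialLaw w q
          {p | ¬ SensorDenoising.Succeeds w r p.1 p.2} ≤ ENNReal.ofReal δ := by
  -- As `γ ≤ 1 / 2`, the constant 200 gives `400 * r * √d ≤ 1`, the square of which is the smallness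
  -- condition `160000 * (d * r ^ 2) ≤ 1` of the geometric part.
  refine ⟨200, 128, by norm_num, by norm_num, ?_⟩
  intro d hd w hw η r δ hη hη' hr hδ hrd N hN q hqm hq
  have hq01 : ∀ i x, 0 ≤ q i x ∧ q i x ≤ 1 := fun i x => ⟨by linarith [(hq i x).1], (hq i x).2⟩
  rcases lt_or_ge 1 δ with hδ1 | hδ1
  · calc _ ≤ SensorDenoising.initialLaw w q {p | p.1 ∈ Set.univ} := measure_mono fun p _ => trivial
      _ ≤ _ := SensorDenoising.initialLaw_fst_le w hqm hq01 Set.univ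
      _ = ENNReal.ofReal 1 := by rw [measure_univ, ENNReal.ofReal_one]
      _ ≤ _ := ENNReal.ofReal_le_ofReal hδ1.le
  -- With no sensors there is no update order, so success is vacuous; the exponent `N - 1` in the
  -- estimates needs `N ≥ 1`.
  obtain rfl | hN1 := Nat.eq_zero_or_pos N
  · have : {p : (Fin 0 → SensorDenoising.Space d) × (Fin 0 → Bool) |
        ¬ SensorDenoising.Succeeds w r p.1 p.2} = ∅ :=
      Set.eq_empty_of_forall_notMem fun p hp => hp fun u => (u 0).elim0
    simp [this]
  have hd' : (2 : ℝ) ≤ d := by exact_mod_cast hd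
  have hrd2 : 160000 * (d * r ^ 2) ≤ 1 := by
    have hsq : Real.sqrt d ^ 2 = d := Real.sq_sqrt (by linarith)
    have hs : 0 < Real.sqrt d := Real.sqrt_pos.2 (by linarith)
    have h1 : r * (200 * Real.sqrt d) ≤ 1 / 2 :=
      ((le_div_iff₀ (by positivity)).1 hrd).trans (by linarith)
    have h2 := pow_le_pow_left₀ (by positivity) h1 2
    nlinarith
  refine (SensorDenoising.initialLaw_not_succeeds_le hd hw hqm (γ := 1 / 2 - η) (by linarith)
    (by linarith) hr hrd2 fun i x => ⟨by linarith [(hq i x).1], (hq i x).2⟩).trans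
    (ENNReal.ofReal_le_ofReal ?_)
  exact SensorDenoising.total_failure_le hd (by linarith) (by linarith) hr hδ hδ1 hrd hN hN1
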